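/- Let $\mathbb F$ be a field and let $q\in\mathbb F$ be nonzero and not a root of unity. For elements $X,Y$ of an $\mathbb F$-algebra write $[X,Y]=XY-YX$ and $[X,Y]_q=qXY-q^{-1}YX$. The $q$-Onsager algebra $\mathcal O_q$ is the associative unital $\mathbb F$-algebra with generators $A,A^*$ and relations $$[A,[A,[A,A^*]_q]_{q^{-1}}]=(q^2-q^{-2})^2[A^*,A],\qquad [A^*,[A^*,[A^*,A]_q]_{q^{-1}}]=(q^2-q^{-2})^2[A,A^*].$$ Let $V$ be an irreducible $\mathcal O_q$-module of finite dimension at least $2$ on which each of $A,A^*$ is diagonalizable. **Orderings.** Consider an integer $d\ge 0$, an ordering $\theta_0,\dots,\theta_d$ of the (distinct) eigenvalues of $A$ on $V$ such that $\theta_{i-1}^2-(q^2+q^{-2})\theta_{i-1}\theta_i+\theta_i^2+(q^2-q^{-2})^2=0$ for $1\le i\le d$, and an ordering $\theta^*_0,\dots,\theta^*_d$ of the (distinct) eigenvalues of $A^*$ on $V$ whose eigenspaces $V^*_i$ satisfy $AV^*_i\subseteq V^*_{i-1}+V^*_i+V^*_{i+1}$ for $0\le i\le d$ (with $V^*_{-1}=V^*_{d+1}=0$).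 Let $V_i$ be the $\theta_i$-eigenspace of $A$. **Scalar and maps.** Given such orderings, let $a\in\mathbb F$ be a nonzero scalar with $\theta_i=aq^{d-2i}+a^{-1}q^{2i-d}$ for $0\le i\le d$. Given sequences of subspaces $(P_i)_{i=0}^d$ and $(Q_i)_{i=0}^d$ of $V$, say that $X\in\mathrm{End}(V)$ is a split map from $(P_i)$ to $(Q_i)$ if there are nonzero subspaces $W_0,\dots,W_d$ whose direct sum is $V$, such that for all $0\le i\le d$: $W_0+\cdots+W_i=P_0+\cdots+P_i$, $W_i+\cdots+W_d=Q_i+\cdots+Q_d$, and $X$ acts on $W_i$ as $q^{d-2i}$. Let $K,B,K^\downarrow,B^\downarrow\in\mathrm{End}(V)$ be split maps: $K$ from $(V^*_i)$ to $(V_i)$; $B$ from $(V^*_i)$ to $(V_{d-i})$; $K^\downarrow$ from $(V^*_{d-i})$ to $(V_i)$; $B^\downarrow$ from $(V^*_{d-i})$ to $(V_{d-i})$. An *equitable triple on $V$* is a triple $X,Y,Z$ of invertible elements of $\mathrm{End}(V)$ with $$\frac{qXY-q^{-1}YX}{q-q^{-1}}=I,\qquad \frac{qYZ-q^{-1}ZY}{q-q^{-1}}=I,\qquad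 \frac{qZX-q^{-1}XZ}{q-q^{-1}}=I.$$ **Proposition.** Orderings as above exist. For every choice of such orderings, a scalar $a$ and maps $K,B,K^\downarrow,B^\downarrow$ as above exist, and for every such $a,K,B,K^\downarrow,B^\downarrow$ the following holds: $a\ne a^{-1}$; the maps $K,B,K^\downarrow,B^\downarrow$ are invertible; the maps $$M=\frac{aK-a^{-1}B}{a-a^{-1}},\quad N=\frac{a^{-1}K^{-1}-aB^{-1}}{a^{-1}-a},\quad M^\downarrow=\frac{aK^\downarrow-a^{-1}B^\downarrow}{a-a^{-1}},\quad N^\downarrow=\frac{a^{-1}(K^\downarrow)^{-1}-a(B^\downarrow)^{-1}}{a^{-1}-a}$$ are invertible; and each of the following eight triples $X,Y,Z$ is an equitable triple on $V$: 1. $aA-a^2K,\ M^{-1},\ K$; 2. $a^{-1}A-a^{-2}B,\ M^{-1},\ B$; 3. $aA-a^2K^\downarrow,\ (M^\downarrow)^{-1},\ K^\downarrow$; 4. $a^{-1}A-a^{-2}B^\downarrow,\ (M^\downarrow)^{-1},\ B^\downarrow$; 5. $K^{-1},\ N^{-1},\ a^{-1}A-a^{-2}K^{-1}$; 6. $B^{-1},\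 N^{-1},\ aA-a^2B^{-1}$; 7. $(K^\downarrow)^{-1},\ (N^\downarrow)^{-1},\ a^{-1}A-a^{-2}(K^\downarrow)^{-1}$; 8. $(B^\downarrow)^{-1},\ (N^\downarrow)^{-1},\ aA-a^2(B^\downarrow)^{-1}$. -/

import Mathlib

/-! The q-Onsager algebra, its modules, and equitable triples. -/

namespace QOns

/-- The `q`-commutator `[X, Y]_q = q X Y - q⁻¹ Y X` in an `F`-algebra. -/
def qComm {F R : Type*} [Field F] [Ring R] [Algebra F R] (q : F) (X Y : R) : R :=
  q • (X * Y) - q⁻¹ • (Y * X)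

/-- The two `q`-Dolan/Grady relations, on the free algebra with generators
`A = ι false` and `A* = ι true`. -/
inductive Rel (F : Type*) [Field F] (q : F) : FreeAlgebra F Bool → FreeAlgebra F Bool → Prop
  | dg (x y : Bool) (hxy : x ≠ y) :
      Rel F q
        ⁅FreeAlgebra.ι F x,
          qComm q⁻¹ (FreeAlgebra.ι F x) (qComm q (FreeAlgebra.ι F x) (FreeAlgebra.ι F y))⁆
        ((q ^ 2 - (q ^ 2)⁻¹) ^ 2 • ⁅FreeAlgebra.ι F y, FreeAlgebra.ι F x⁆)

/-- The `q`-Onsager algebra `𝒪_q` over the field `F`. -/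
abbrev QOnsager (F : Type*) [Field F] (q : F) : Type _ := RingQuot (Rel F q)

/-- The standard generator `A` of `𝒪_q`. -/
noncomputable def QOnsager.A (F : Type*) [Field F] (q : F) : QOnsager F q :=
  RingQuot.mkAlgHom F (Rel F q) (FreeAlgebra.ι F false)

/-- The standard generator `A*` of `𝒪_q`. -/
noncomputable def QOnsager.As (F : Type*) [Field F] (q : F) : QOnsager F q :=
  RingQuot.mkAlgHom F (Rel F q) (FreeAlgebra.ι F true)

section action

variable {F : Type*} [Field F] (q : F) (V : Type*) [AddCommGroup V] [Module F V]
  [Module (QOnsager F q) V] [IsScalarTower F (QOnsager F q) V]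

/-- The action of `A` on the `𝒪_q`-module `V`. -/
noncomputable def actA : Module.End F V := Algebra.lsmul F F V (QOnsager.A F q)

/-- The action of `A*` on the `𝒪_q`-module `V`. -/
noncomputable def actAs : Module.End F V := Algebra.lsmul F F V (QOnsager.As F q)

end action

section linear

variable {F : Type*} [Field F] {V : Type*} [AddCommGroup V] [Module F V]

/-- `X` is diagonalizable: `V` is spanned by the eigenspaces of `X`. -/
def IsDiagonalizable (X : Module.End F V) : Prop :=
  ⨆ μ : F, Module.End.eigenspace X μ = ⊤

/-- Two distinct scalars `l, m` are adjacent if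
`l² - (q² + q⁻²) l m + m² + (q² - q⁻²)² = 0`. -/
def Adjacent (q l m : F) : Prop :=
  l ≠ m ∧ l ^ 2 - (q ^ 2 + (q ^ 2)⁻¹) * l * m + m ^ 2 + (q ^ 2 - (q ^ 2)⁻¹) ^ 2 = 0

/-- `θ 0, …, θ d` lists the eigenvalues of `X`, each exactly once. -/
structure IsEigenvalueList (X : Module.End F V) {d : ℕ} (θ : Fin (d + 1) → F) : Prop where
  injective : Function.Injective θ
  mem_iff : ∀ l : F, (∃ i, θ i = l) ↔ Module.End.HasEigenvalue X l

/-- A decomposition of `V`: nonzero subspaces `W 0, …, W d` whose direct sum is `V`. -/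
structure IsDecomposition {d : ℕ} (W : Fin (d + 1) → Submodule F V) : Prop where
  ne_bot : ∀ i, W i ≠ ⊥
  internal : DirectSum.IsInternal W

/-- `X` is the map corresponding to `W`: it acts on `W i` as the scalar `q ^ (d - 2 i)`. -/
def IsCorrespondingMap (q : F) {d : ℕ} (W : Fin (d + 1) → Submodule F V)
    (X : Module.End F V) : Prop :=
  ∀ i, ∀ w ∈ W i, X w = q ^ ((d : ℤ) - 2 * ((i : ℕ) : ℤ)) • w

/-- `X` corresponds to a decomposition `W` of `V` that is drawn from `P` to `Q`:
`W 0 + ⋯ + W i = P 0 + ⋯ + P i` and `W i + ⋯ + W d = Q i + ⋯ + Q d` for all `i`. -/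
def IsSplitMap (q : F) {d : ℕ} (P Q : Fin (d + 1) → Submodule F V)
    (X : Module.End F V) : Prop :=
  ∃ W : Fin (d + 1) → Submodule F V,
    IsDecomposition W ∧
    (∀ i, ⨆ j ∈ Set.Iic i, W j = ⨆ j ∈ Set.Iic i, P j) ∧
    (∀ i, ⨆ j ∈ Set.Ici i, W j = ⨆ j ∈ Set.Ici i, Q j) ∧
    IsCorrespondingMap q W X

/-- The `q`-Weyl relation `(q X Y - q⁻¹ Y X) / (q - q⁻¹) = I`. -/
def QWeyl (q : F) (X Y : Module.End F V) : Prop :=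
  (q - q⁻¹)⁻¹ • qComm q X Y = 1

/-- Equitable triples on `V`. -/
structure IsEquitable (q : F) (X Y Z : Module.End F V) : Prop where
  isUnit_X : IsUnit X
  isUnit_Y : IsUnit Y
  isUnit_Z : IsUnit Z
  weyl_XY : QWeyl q X Y
  weyl_YZ : QWeyl q Y Z
  weyl_ZX : QWeyl q Z X

/-- `M = (a K - a⁻¹ B) / (a - a⁻¹)`. -/
noncomputable def mapM (a : F) (K B : Module.End F V) : Module.End F V :=
  (a - a⁻¹)⁻¹ • (a • K - a⁻¹ • B)

/-- `N = (a⁻¹ K⁻¹ - a B⁻¹) / (a⁻¹ - a)`; `Ring.inverse` is the inverse in `End(V)` of an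
invertible map. -/
noncomputable def mapN (a : F) (K B : Module.End F V) : Module.End F V :=
  (a⁻¹ - a)⁻¹ • (a⁻¹ • Ring.inverse K - a • Ring.inverse B)

end linear

section setup

variable {F : Type*} [Field F] (q : F) (V : Type*) [AddCommGroup V] [Module F V]
  [Module (QOnsager F q) V] [IsScalarTower F (QOnsager F q) V]

/-- `θ` and `θs` are orderings of the eigenvalues of `A` and of `A*` on `V` such that consecutive
`θ i` are adjacent, and `A V*_i ⊆ V*_{i-1} + V*_i + V*_{i+1}` for the eigenspaces `V*_i` of `A*`
(where `V*_{-1} = V*_{d+1} = 0`). -/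
structure IsStandardOrdering {d : ℕ} (θ θs : Fin (d + 1) → F) : Prop where
  list_A : IsEigenvalueList (actA q V) θ
  list_As : IsEigenvalueList (actAs q V) θs
  adjacent : ∀ i j : Fin (d + 1), (i : ℕ) + 1 = (j : ℕ) → Adjacent q (θ i) (θ j)
  three_term : ∀ i : Fin (d + 1),
    Submodule.map (actA q V) (Module.End.eigenspace (actAs q V) (θs i)) ≤
      ⨆ j ∈ {j : Fin (d + 1) | (i : ℕ) ≤ (j : ℕ) + 1 ∧ (j : ℕ) ≤ (i : ℕ) + 1},
        Module.End.eigenspace (actAs q V) (θs j)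

/-- The eigenspaces `V_i` of `A`. -/
noncomputable def eigA {d : ℕ} (θ : Fin (d + 1) → F) (i : Fin (d + 1)) : Submodule F V :=
  Module.End.eigenspace (actA q V) (θ i)

/-- The eigenspaces `V*_i` of `A*`. -/
noncomputable def eigAs {d : ℕ} (θs : Fin (d + 1) → F) (i : Fin (d + 1)) : Submodule F V :=
  Module.End.eigenspace (actAs q V) (θs i)

/-- The nonzero scalar `a` with `θ_i = a q^{d-2i} + a⁻¹ q^{2i-d}`, and the maps `K`, `B`, `K↓`,
`B↓` of the split decompositions attached to the orderings `θ`, `θs`. Composition with `Fin.rev`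
inverts a sequence of subspaces. -/
structure IsSplitData {d : ℕ} (θ θs : Fin (d + 1) → F) (a : F)
    (K B Kd Bd : Module.End F V) : Prop where
  a_ne_zero : a ≠ 0
  theta_eq : ∀ i : Fin (d + 1),
    θ i = a * q ^ ((d : ℤ) - 2 * ((i : ℕ) : ℤ)) + a⁻¹ * q ^ (2 * ((i : ℕ) : ℤ) - (d : ℤ))
  map_K : IsSplitMap q (eigAs q V θs) (eigA q V θ) K
  map_B : IsSplitMap q (eigAs q V θs) (eigA q V θ ∘ Fin.rev) B
  map_Kd : IsSplitMap q (eigAs q V θs ∘ Fin.rev) (eigA q V θ) Kd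
  map_Bd : IsSplitMap q (eigAs q V θs ∘ Fin.rev) (eigA q V θ ∘ Fin.rev) Bd

end setup

end QOns

/-! Applied to a θ-eigenvector of A, the first Dolan/Grady relation is a cubic in A whose roots are
θ and the scalars adjacent to θ (`DolanGrady.apply_mem`); the same holds with A and A* exchanged.
Every scalar has at most two neighbours, so irreducibility forces the eigenvalues to form one path,
and a path solves a linear recurrence, whence θ_i = a q^{d-2i} + a⁻¹ q^{2i-d} (for A* with a scalar
b). With such eigenvalues only consecutive ones are adjacent, so each of A, A* acts tridiagonally on
the eigenspaces of the other.

Tridiagonality and irreducibility show that U_n = (V*_0 + ⋯ + V*_n) ∩ (V_n + ⋯ + V_d) decomposes V.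
This is the only decomposition that a split map K can come from. As A - θ_n raises U_n, A* - θ*_n
lowers it, and K is q^{d-2n} on it, K satisfies a quadratic q-commutation relation with each of A
and A* (`quadraticWeyl`, `quadraticWeyl_dual`). The same holds for B, with a inverted and b
unchanged.

The heart is a quadratic relation D = 0 between K and B (`quadraticDefect_eq_zero`). The expression
D can be moved past A and past A* at the cost of terms having D as a factor next to K or B. Hence
the largest K,B-stable subspace of ker D is stable under A and A*. It contains V*_0, where K and B
are the same scalar, so it is V.

The equitable relations are linear combinations of D = 0 and the relations with A, and invertibility
holds because every map involved is triangular on a flag with nonzero diagonal. The eight triples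
come from one by exchanging K with B (a becomes a⁻¹), by inverting K and B (q and a are inverted,
the triple is reversed; `quadraticDefect_inverse`), and by reversing the order of the V*_i. -/

namespace QOns

open Module.End

/-! ### Dolan/Grady relations and adjacency of eigenvalues. -/

section pairs

variable {F : Type*} [Field F] {V : Type*} [AddCommGroup V] [Module F V]

/-- The `q`-Dolan/Grady relation for an ordered pair of endomorphisms. -/
def DolanGrady (q : F) (X Y : Module.End F V) : Prop :=
  ⁅X, qComm q⁻¹ X (qComm q X Y)⁆ = (q ^ 2 - (q ^ 2)⁻¹) ^ 2 • ⁅Y, X⁆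

/-- The only subspaces stable under both `X` and `Y` are `0` and the whole space. -/
def IsIrreduciblePair (X Y : Module.End F V) : Prop :=
  ∀ U : Submodule F V, (∀ v ∈ U, X v ∈ U) → (∀ v ∈ U, Y v ∈ U) → U = ⊥ ∨ U = ⊤

lemma IsIrreduciblePair.symm {X Y : Module.End F V} (h : IsIrreduciblePair X Y) :
    IsIrreduciblePair Y X := fun U hX hY => h U hY hX

/-- `X` acts on the family `P` in a tridiagonal fashion. -/
def IsTridiagonalOn (X : Module.End F V) {d : ℕ} (P : Fin (d + 1) → Submodule F V) : Prop :=
  ∀ i : Fin (d + 1), Submodule.map X (P i) ≤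
    ⨆ j ∈ {j : Fin (d + 1) | (i : ℕ) ≤ (j : ℕ) + 1 ∧ (j : ℕ) ≤ (i : ℕ) + 1}, P j

lemma biSup_inf_biSup {ι : Type*} {P : ι → Submodule F V} (hP : iSupIndep P) (S T : Set ι) :
    (⨆ i ∈ S, P i) ⊓ (⨆ i ∈ T, P i) = ⨆ i ∈ S ∩ T, P i := by
  have h1 : (⨆ i ∈ S, P i) = (⨆ i ∈ S ∩ T, P i) ⊔ ⨆ i ∈ S \ T, P i := by
    rw [← iSup_union, Set.inter_union_sdiff]
  have h2 : (⨆ i ∈ S ∩ T, P i) ≤ ⨆ i ∈ T, P i := biSup_mono fun i hi => hi.2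
  rw [h1, sup_inf_assoc_of_le _ h2,
    (hP.disjoint_biSup_biSup Set.disjoint_sdiff_left).eq_bot, sup_bot_eq]

/-- Split u into eigenvectors: p(X) scales each by p(l), and independence makes every scaled
component vanish. -/
lemma mem_biSup_of_aeval_eq_zero {X : Module.End F V} (hX : IsDiagonalizable X)
    (p : Polynomial F) {u : V} (hu : Polynomial.aeval X p u = 0) :
    u ∈ ⨆ l ∈ {l | p.eval l = 0}, eigenspace X l := by
  have hmem : u ∈ ⨆ l, eigenspace X l := by rw [hX]; trivial
  obtain ⟨f, hf, rfl⟩ := (Submodule.mem_iSup_iff_exists_finsupp _ _).mp hmem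
  have hind := (iSupIndep_iff_finsetSum_eq_zero_imp_eq_zero _).mp X.eigenspaces_iSupIndep
  have key : ∀ l, Polynomial.aeval X p (f l) = p.eval l • f l := fun l =>
    aeval_apply_of_mem_apply_eq_smul (mem_eigenspace_iff.mp (hf l))
  have h0 := hind f.support (fun l => p.eval l • f l)
    (fun l _ => Submodule.smul_mem _ _ (hf l)) (by
      rw [← hu, Finsupp.sum, map_sum]
      exact Finset.sum_congr rfl fun l _ => (key l).symm)
  refine Submodule.sum_mem _ fun l hl => ?_
  have hz := (smul_eq_zero.mp (h0 l hl)).resolve_right (Finsupp.mem_support_iff.mp hl)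
  exact Submodule.mem_iSup_of_mem l (Submodule.mem_iSup_of_mem hz (hf l))

/-- Since X v = m v, the relation evaluated at v says that p(X) kills Y v, where p is X - m times
the adjacency quadratic in m. -/
lemma DolanGrady.apply_mem {q : F} (hq0 : q ≠ 0) {X Y : Module.End F V} (h : DolanGrady q X Y)
    (hX : IsDiagonalizable X) {m : F} {v : V} (hv : v ∈ eigenspace X m) :
    Y v ∈ ⨆ l ∈ {l | l = m ∨ Adjacent q l m}, eigenspace X l := by
  have hXv : X v = m • v := mem_eigenspace_iff.mp hv
  let p : Polynomial F := (Polynomial.X - Polynomial.C m) *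
    (Polynomial.X ^ 2 - Polynomial.C ((q ^ 2 + (q ^ 2)⁻¹) * m) * Polynomial.X
      + Polynomial.C (m ^ 2 + (q ^ 2 - (q ^ 2)⁻¹) ^ 2))
  have hp : Polynomial.aeval X p (Y v) = 0 := by
    have h' := LinearMap.congr_fun h v
    simp only [LieRing.of_associative_ring_bracket, qComm, inv_inv, LinearMap.sub_apply,
      LinearMap.smul_apply, Module.End.mul_apply, hXv, map_sub, map_smul] at h'
    rw [← sub_eq_zero] at h'
    rw [← h']
    simp only [p, map_mul, map_sub, map_add, Polynomial.aeval_X, Polynomial.aeval_C,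
      LinearMap.sub_apply, Module.End.mul_apply, Module.algebraMap_end_apply,
      LinearMap.add_apply, pow_two, map_smul]
    match_scalars <;> field_simp <;> ring
  have := mem_biSup_of_aeval_eq_zero hX p hp
  refine (biSup_mono (fun l hl => ?_) : (_ : Submodule F V) ≤ _) this
  by_cases hlm : l = m
  · exact Or.inl hlm
  · refine Or.inr ⟨hlm, ?_⟩
    have hl' : p.eval l = 0 := hl
    simp only [p, Polynomial.eval_mul, Polynomial.eval_sub, Polynomial.eval_X,
      Polynomial.eval_C, Polynomial.eval_add, Polynomial.eval_pow, mul_eq_zero, sub_eq_zero,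
      hlm, false_or] at hl'
    linear_combination hl'

namespace IsEigenvalueList

variable {X : Module.End F V} {d : ℕ} {θ : Fin (d + 1) → F}

lemma biSup_le (h : IsEigenvalueList X θ) (S : Set F) :
    ⨆ l ∈ S, eigenspace X l ≤ ⨆ i ∈ {i | θ i ∈ S}, eigenspace X (θ i) := by
  refine iSup₂_le fun l hl => ?_
  by_cases hl' : HasEigenvalue X l
  · obtain ⟨i, rfl⟩ := (h.mem_iff l).mpr hl'
    exact le_biSup (fun i => eigenspace X (θ i)) hl
  · rw [HasEigenvalue, HasUnifEigenvalue, not_not] at hl'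
    exact hl'.trans_le bot_le

lemma iSup_eq_top (h : IsEigenvalueList X θ) (hX : IsDiagonalizable X) :
    ⨆ i, eigenspace X (θ i) = ⊤ := by
  have := h.biSup_le Set.univ
  simp only [Set.mem_univ, iSup_pos, Set.ofPred_true] at this
  exact top_le_iff.mp (hX ▸ this)

lemma iSupIndep (h : IsEigenvalueList X θ) : iSupIndep fun i => eigenspace X (θ i) :=
  X.eigenspaces_iSupIndep.comp h.injective

lemma ne_bot (h : IsEigenvalueList X θ) (i : Fin (d + 1)) : eigenspace X (θ i) ≠ ⊥ :=
  (h.mem_iff _).mp ⟨i, rfl⟩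

lemma comp_rev (h : IsEigenvalueList X θ) : IsEigenvalueList X (θ ∘ Fin.rev) :=
  ⟨h.injective.comp Fin.rev_injective, fun l => by
    rw [← h.mem_iff]
    exact ⟨fun ⟨i, hi⟩ => ⟨_, hi⟩, fun ⟨i, hi⟩ => ⟨i.rev, by simpa using hi⟩⟩⟩

end IsEigenvalueList

lemma DolanGrady.isTridiagonalOn {q : F} (hq0 : q ≠ 0) {X Y : Module.End F V}
    (h : DolanGrady q X Y) (hX : IsDiagonalizable X) {d : ℕ} {θ : Fin (d + 1) → F}
    (hθ : IsEigenvalueList X θ)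
    (hadj : ∀ i j : Fin (d + 1), Adjacent q (θ i) (θ j) →
      (i : ℕ) + 1 = (j : ℕ) ∨ (j : ℕ) + 1 = (i : ℕ)) :
    IsTridiagonalOn Y fun i => eigenspace X (θ i) := by
  rintro i _ ⟨v, hv, rfl⟩
  refine (biSup_mono ?_ : (_ : Submodule F V) ≤ _) (hθ.biSup_le _ (h.apply_mem hq0 hX hv))
  rintro j (hj | hj)
  · have := hθ.injective hj
    subst this
    simp
  · have := hadj j i hj
    simp only [Set.mem_ofPred_eq]
    omega

lemma IsTridiagonalOn.comp_rev {X : Module.End F V} {d : ℕ} {P : Fin (d + 1) → Submodule F V}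
    (h : IsTridiagonalOn X P) : IsTridiagonalOn X (P ∘ Fin.rev) := by
  intro i
  refine (h i.rev).trans (iSup₂_le fun j hj => ?_)
  have : P j = (P ∘ Fin.rev) j.rev := by simp
  rw [this]
  refine le_biSup (P ∘ Fin.rev) ?_
  simp only [Set.mem_ofPred_eq, Fin.val_rev] at hj ⊢
  omega

lemma Adjacent.symm {q l m : F} (h : Adjacent q l m) : Adjacent q m l :=
  ⟨h.1.symm, by linear_combination h.2⟩

/-- A scalar has at most two neighbours for the adjacency relation. -/
lemma Adjacent.eq_or_eq {q l m n k : F} (hl : Adjacent q l k) (hm : Adjacent q m k)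
    (hn : Adjacent q n k) (hmn : m ≠ n) : l = m ∨ l = n := by
  by_contra! hcon
  -- Two distinct neighbours of k add up to (q² + q⁻²)k, so one determines the other.
  have h1 : (l - m) * (l + m - (q ^ 2 + (q ^ 2)⁻¹) * k) = 0 := by
    linear_combination hl.2 - hm.2
  have h2 : (l - n) * (l + n - (q ^ 2 + (q ^ 2)⁻¹) * k) = 0 := by
    linear_combination hl.2 - hn.2
  have h1' := (mul_eq_zero.mp h1).resolve_left (sub_ne_zero.mpr hcon.1)
  have h2' := (mul_eq_zero.mp h2).resolve_left (sub_ne_zero.mpr hcon.2)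
  exact hmn (by linear_combination h1' - h2')

end pairs

/-! ### Eigenvalue paths and their parametrization. -/

section eigenvalues

variable {F : Type*} [Field F] {V : Type*} [AddCommGroup V] [Module F V]

/-- `θ` lists distinct eigenvalues of `X`, consecutive ones being adjacent. -/
structure IsEigenvaluePath (q : F) (X : Module.End F V) {d : ℕ} (θ : Fin (d + 1) → F) : Prop where
  injective : Function.Injective θ
  hasEigenvalue : ∀ i, HasEigenvalue X (θ i)
  adjacent : ∀ i j : Fin (d + 1), (i : ℕ) + 1 = (j : ℕ) → Adjacent q (θ i) (θ j)

namespace IsEigenvaluePath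

variable {q : F} {X : Module.End F V} {d : ℕ} {θ : Fin (d + 1) → F}

lemma comp_rev (h : IsEigenvaluePath q X θ) : IsEigenvaluePath q X (θ ∘ Fin.rev) :=
  ⟨h.injective.comp Fin.rev_injective, fun i => h.hasEigenvalue _, fun i j hij =>
    (h.adjacent j.rev i.rev (by simp only [Fin.val_rev]; omega)).symm⟩

lemma cons (h : IsEigenvaluePath q X θ) {l : F} (hl : HasEigenvalue X l)
    (hadj : Adjacent q l (θ 0)) (hmem : ∀ i, θ i ≠ l) :
    IsEigenvaluePath q X (Fin.cons l θ : Fin (d + 1 + 1) → F) := by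
  refine ⟨Fin.cons_injective_iff.mpr ⟨fun ⟨i, hi⟩ => hmem i hi, h.injective⟩, fun i => ?_,
    fun i j hij => ?_⟩
  · induction i using Fin.cases with
    | zero => simpa using hl
    | succ i => simpa using h.hasEigenvalue i
  · induction j using Fin.cases with
    | zero => simp at hij
    | succ j =>
      induction i using Fin.cases with
      | zero =>
        have : j = 0 := Fin.ext (by simpa using hij.symm)
        subst this
        simpa using hadj
      | succ i => simpa using h.adjacent i j (by simpa using hij)

/-- Otherwise there would be paths of every length, against the finiteness of the spectrum. -/
lemma exists_maximal [FiniteDimensional F V] (q : F) {l : F} (hl : HasEigenvalue X l) :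
    ∃ (d : ℕ) (θ : Fin (d + 1) → F), IsEigenvaluePath q X θ ∧
      ∀ θ' : Fin (d + 1 + 1) → F, ¬ IsEigenvaluePath q X θ' := by
  by_contra! hcon
  have hall : ∀ n : ℕ, ∃ θ : Fin (n + 1) → F, IsEigenvaluePath q X θ := by
    intro n
    induction n with
    | zero =>
      refine ⟨fun _ => l, fun i j _ => Fin.ext (by omega), fun _ => hl, fun i j hij => ?_⟩
      omega
    | succ n ih =>
      obtain ⟨θ, hθ⟩ := ih
      exact hcon n θ hθ
  have hfin : Finite {μ | X.HasEigenvalue μ} := X.finite_hasEigenvalue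
  obtain ⟨θ, hθ⟩ := hall (Nat.card {μ | X.HasEigenvalue μ})
  have := Nat.card_le_card_of_injective
    (fun i => (⟨θ i, hθ.hasEigenvalue i⟩ : {μ | X.HasEigenvalue μ}))
    (fun i j hij => hθ.injective (congrArg Subtype.val hij))
  rw [Nat.card_fin] at this
  exact Nat.not_succ_le_self _ this

/-- At an endpoint a new neighbour would extend the path; at an interior point it would be a third
neighbour. -/
lemma mem_range_of_adjacent (h : IsEigenvaluePath q X θ)
    (hmax : ∀ θ' : Fin (d + 1 + 1) → F, ¬ IsEigenvaluePath q X θ') {l : F}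
    (hl : HasEigenvalue X l) {i : Fin (d + 1)} (hadj : Adjacent q l (θ i)) : ∃ j, θ j = l := by
  by_contra! hcon
  by_cases h0 : (i : ℕ) = 0
  · obtain rfl : i = 0 := Fin.ext h0
    exact hmax _ (h.cons hl hadj hcon)
  by_cases hd : (i : ℕ) = d
  · obtain rfl : i = Fin.rev 0 := Fin.ext (by simp [hd])
    exact hmax _ (h.comp_rev.cons hl hadj fun j => hcon _)
  · have hi := i.isLt
    let j : Fin (d + 1) := ⟨i - 1, by omega⟩
    let k : Fin (d + 1) := ⟨i + 1, by omega⟩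
    have h1 := h.adjacent j i (by simp only [j]; omega)
    have h2 := (h.adjacent i k rfl).symm
    have hjk : θ j ≠ θ k := fun e => by
      have := Fin.ext_iff.mp (h.injective e)
      simp only [j, k] at this
      omega
    rcases hadj.eq_or_eq h1 h2 hjk with e | e
    · exact hcon j e.symm
    · exact hcon k e.symm

end IsEigenvaluePath

lemma exists_hasEigenvalue [Nontrivial V] {X : Module.End F V} (hX : IsDiagonalizable X) :
    ∃ l, HasEigenvalue X l := by
  by_contra! hcon
  have : (⊤ : Submodule F V) = ⊥ := by
    rw [← hX, iSup_eq_bot]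
    intro l
    have := hcon l
    rwa [HasEigenvalue, HasUnifEigenvalue, not_not] at this
  exact top_ne_bot this

/-- The eigenspaces along a maximal path span a subspace stable under X and Y, hence all of V, so no
eigenvalue lies off the path. -/
lemma exists_eigenvalueList [FiniteDimensional F V] [Nontrivial V] {q : F} (hq0 : q ≠ 0)
    {X Y : Module.End F V} (hX : IsDiagonalizable X) (hXY : DolanGrady q X Y)
    (hirr : IsIrreduciblePair X Y) :
    ∃ (d : ℕ) (θ : Fin (d + 1) → F), IsEigenvalueList X θ ∧
      ∀ i j : Fin (d + 1), (i : ℕ) + 1 = (j : ℕ) → Adjacent q (θ i) (θ j) := by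
  obtain ⟨l, hl⟩ := exists_hasEigenvalue hX
  obtain ⟨d, θ, hθ, hmax⟩ := IsEigenvaluePath.exists_maximal q hl
  refine ⟨d, θ, ⟨hθ.injective, fun m => ⟨?_, fun hm => ?_⟩⟩, hθ.adjacent⟩
  · rintro ⟨i, rfl⟩
    exact hθ.hasEigenvalue i
  let U : Submodule F V := ⨆ m ∈ Set.range θ, eigenspace X m
  have hUX : ∀ v ∈ U, X v ∈ U := by
    have : U ≤ U.comap X := iSup₂_le fun m hm v hv => by
      rw [Submodule.mem_comap, mem_eigenspace_iff.mp hv]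
      exact U.smul_mem _ (Submodule.mem_iSup_of_mem m (Submodule.mem_iSup_of_mem hm hv))
    exact this
  have hUY : ∀ v ∈ U, Y v ∈ U := by
    have : U ≤ U.comap Y := iSup₂_le fun m hm v hv => by
      refine (iSup₂_le fun k hk => ?_ : (_ : Submodule F V) ≤ U) (hXY.apply_mem hq0 hX hv)
      by_cases hk' : HasEigenvalue X k
      · rcases hk with rfl | hk
        · exact le_biSup (fun m => eigenspace X m) hm
        · obtain ⟨i, rfl⟩ := hm
          obtain ⟨j, rfl⟩ := hθ.mem_range_of_adjacent hmax hk' hk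
          exact le_biSup (fun m => eigenspace X m) (Set.mem_range_self j)
      · rw [HasEigenvalue, HasUnifEigenvalue, not_not] at hk'
        exact hk'.trans_le bot_le
    exact this
  have hUtop : U = ⊤ := by
    refine (hirr U hUX hUY).resolve_left fun hbot => hθ.hasEigenvalue 0 (le_bot_iff.mp ?_)
    rw [← hbot]
    exact le_biSup (fun m => eigenspace X m) (Set.mem_range_self 0)
  by_contra hcon
  have hdis := (X.eigenspaces_iSupIndep).disjoint_biSup (x := m) (y := Set.range θ) hcon
  have hU' : ⨆ m ∈ Set.range θ, eigenspace X m = ⊤ := hUtop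
  rw [hU', disjoint_top] at hdis
  exact hm hdis

/-- If X were scalar, an eigenvector of Y would span a stable line. -/
lemma pos_of_isEigenvalueList (hdim : 2 ≤ Module.finrank F V) {X Y : Module.End F V}
    (hX : IsDiagonalizable X) (hY : IsDiagonalizable Y) (hirr : IsIrreduciblePair X Y)
    {d : ℕ} {θ : Fin (d + 1) → F} (hθ : IsEigenvalueList X θ) : 0 < d := by
  by_contra! hd
  obtain rfl : d = 0 := by omega
  have : Nontrivial V := Module.nontrivial_of_finrank_pos (R := F) (by omega)
  have htop : eigenspace X (θ 0) = ⊤ := by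
    refine top_le_iff.mp ((hθ.iSup_eq_top hX).ge.trans (iSup_le fun i => ?_))
    rw [show i = 0 from Fin.ext (by omega)]
  obtain ⟨l, hl⟩ := exists_hasEigenvalue hY
  obtain ⟨v, hv⟩ := hl.exists_hasEigenvector
  have hspan := hirr (F ∙ v)
    (fun w hw => by
      have : w ∈ eigenspace X (θ 0) := by rw [htop]; trivial
      rw [mem_eigenspace_iff.mp this]
      exact Submodule.smul_mem _ _ hw)
    (fun w hw => by
      obtain ⟨c, rfl⟩ := Submodule.mem_span_singleton.mp hw
      rw [map_smul, hv.apply_eq_smul]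
      exact Submodule.smul_mem _ _ (Submodule.smul_mem _ _ (Submodule.mem_span_singleton_self v)))
  rcases hspan with h | h
  · exact hv.2 (Submodule.span_singleton_eq_bot.mp h)
  · have := finrank_span_singleton (K := F) hv.2
    rw [h, finrank_top] at this
    omega

lemma zpow_injective_of_not_root_of_unity {q : F} (hq0 : q ≠ 0)
    (hq : ∀ n : ℕ, 0 < n → q ^ n ≠ 1) : Function.Injective fun n : ℤ => q ^ n := by
  have key : ∀ n : ℤ, q ^ n = 1 → n = 0 := by
    intro n hn
    by_contra h
    apply hq n.natAbs (by omega)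
    rcases Int.natAbs_eq n with e | e
    · rwa [e, zpow_natCast] at hn
    · rw [e, zpow_neg, zpow_natCast, inv_eq_one] at hn
      exact hn
  intro m n h
  have := key (m - n) (by rw [zpow_sub₀ hq0, div_eq_one_iff_eq (zpow_ne_zero _ hq0)]; exact h)
  omega

/-- `θ i = a q^{d-2i} + a⁻¹ q^{2i-d}` for all `i`. -/
def IsRacahSequence (q a : F) {d : ℕ} (θ : Fin (d + 1) → F) : Prop :=
  ∀ i : Fin (d + 1),
    θ i = a * q ^ ((d : ℤ) - 2 * ((i : ℕ) : ℤ)) + a⁻¹ * q ^ (2 * ((i : ℕ) : ℤ) - (d : ℤ))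

lemma IsRacahSequence.comp_rev {q a : F} {d : ℕ} {θ : Fin (d + 1) → F}
    (h : IsRacahSequence q a θ) : IsRacahSequence q a⁻¹ (θ ∘ Fin.rev) := by
  intro i
  have hi := i.isLt
  have e : ((d + 1 - ((i : ℕ) + 1) : ℕ) : ℤ) = d - (i : ℕ) := by omega
  rw [Function.comp_apply, h, Fin.val_rev, e, inv_inv, add_comm]
  congr 3 <;> ring

lemma exists_isRacahSequence {q : F} (hq0 : q ≠ 0) (hq : ∀ n : ℕ, 0 < n → q ^ n ≠ 1)
    {d : ℕ} (hd : 0 < d) {θ : Fin (d + 1) → F} (hinj : Function.Injective θ)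
    (hadj : ∀ i j : Fin (d + 1), (i : ℕ) + 1 = (j : ℕ) → Adjacent q (θ i) (θ j)) :
    ∃ a : F, a ≠ 0 ∧ IsRacahSequence q a θ := by
  have hq4 : q ^ 4 - 1 ≠ 0 := sub_ne_zero.mpr (hq 4 (by norm_num))
  -- The value 0 beyond d is never used; natural number indices make the recurrence convenient.
  set t : ℕ → F := fun n => if h : n < d + 1 then θ ⟨n, h⟩ else 0 with ht
  have htθ : ∀ n (h : n < d + 1), t n = θ ⟨n, h⟩ := fun n h => dif_pos h
  have hadj' : ∀ n, n + 1 < d + 1 → Adjacent q (t n) (t (n + 1)) := fun n h => by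
    rw [htθ n (by omega), htθ (n + 1) h]
    exact hadj _ _ rfl
  -- The scalars x and y solve t 0 = x + y and t 1 = x q⁻² + y q²; adjacency of t 0 and t 1 then
  -- says xy = 1.
  obtain ⟨x, hx⟩ : ∃ x, x = q ^ 2 * (q ^ 2 * t 0 - t 1) / (q ^ 4 - 1) := ⟨_, rfl⟩
  obtain ⟨y, hy⟩ : ∃ y, y = (q ^ 2 * t 1 - t 0) / (q ^ 4 - 1) := ⟨_, rfl⟩
  have hxy : x * y = 1 := by
    have h := (hadj' 0 (by omega)).2
    rw [zero_add] at h
    rw [hx, hy]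
    field_simp at h ⊢
    linear_combination (-1 : F) * h
  have hx0 : x ≠ 0 := left_ne_zero_of_mul_eq_one hxy
  have hy' : y = x⁻¹ := (inv_eq_of_mul_eq_one_right hxy).symm
  have hrec : ∀ n, (n < d + 1 → t n = x * (q ^ (2 * n))⁻¹ + y * q ^ (2 * n)) ∧
      (n + 1 < d + 1 → t (n + 1) = x * (q ^ (2 * (n + 1)))⁻¹ + y * q ^ (2 * (n + 1))) := by
    intro n
    induction n with
    | zero =>
      refine ⟨fun _ => ?_, fun _ => ?_⟩
      · rw [hx, hy]
        field_simp
        ring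
      · rw [hx, hy]
        field_simp
        ring
    | succ n ih =>
      refine ⟨ih.2, fun h => ?_⟩
      have h1 := hadj' n (by omega)
      have h2 := hadj' (n + 1) h
      have hne : t n ≠ t (n + 1 + 1) := by
        rw [htθ n (by omega), htθ _ h]
        intro e
        have := Fin.ext_iff.mp (hinj e)
        simp only at this
        omega
      -- The difference of two consecutive adjacency equations; cancelling the nonzero factor leaves
      -- a linear recurrence with characteristic roots q² and q⁻².
      have h3 : (t n - t (n + 1 + 1)) *
          (t n + t (n + 1 + 1) - (q ^ 2 + (q ^ 2)⁻¹) * t (n + 1)) = 0 := by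
        linear_combination h1.2 - h2.2
      have h4 := (mul_eq_zero.mp h3).resolve_left (sub_ne_zero.mpr hne)
      rw [ih.1 (by omega), ih.2 (by omega)] at h4
      rw [← sub_eq_zero, ← h4]
      field_simp
      ring
  refine ⟨x * (q ^ d)⁻¹, mul_ne_zero hx0 (inv_ne_zero (pow_ne_zero _ hq0)), fun i => ?_⟩
  have := (hrec i).1 i.isLt
  rw [htθ i i.isLt] at this
  rw [Fin.eta] at this
  rw [this, hy', zpow_sub₀ hq0, zpow_sub₀ hq0, mul_comm (2 : ℤ), mul_comm 2 (i : ℕ)]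
  norm_cast
  field_simp

lemma IsRacahSequence.sub_inv_ne_zero {q a : F} {d : ℕ} (hd : 0 < d) {θ : Fin (d + 1) → F}
    (hinj : Function.Injective θ) (h : IsRacahSequence q a θ) : a - a⁻¹ ≠ 0 := by
  intro ha
  have ha' : a⁻¹ = a := (sub_eq_zero.mp ha).symm
  have e : θ 0 = θ (Fin.last d) := by
    rw [h, h, ha', add_comm]
    congr 3 <;> simp <;> ring
  have := congrArg Fin.val (hinj e)
  simp at this
  omega

/-- Equality would interchange the two summands of θ i with those of θ j, making these eigenvalues
equal. -/
lemma IsRacahSequence.sq_ne_zpow {q a : F} (hq0 : q ≠ 0) (ha : a ≠ 0) {d : ℕ}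
    {θ : Fin (d + 1) → F} (hinj : Function.Injective θ) (h : IsRacahSequence q a θ)
    {i j : Fin (d + 1)} (hij : i ≠ j) :
    a ^ 2 ≠ q ^ (2 * (((i : ℕ) : ℤ) + ((j : ℕ) : ℤ) - d)) := by
  intro e
  apply hij
  apply hinj
  rw [h, h]
  have key : ∀ m n : ℤ, a ^ 2 = q ^ (m + n) → a * q ^ (-m) = a⁻¹ * q ^ n := by
    intro m n e
    rw [zpow_add₀ hq0] at e
    rw [zpow_neg]
    have := zpow_ne_zero m hq0
    field_simp
    linear_combination e
  have h1 := key (2 * ((i : ℕ) : ℤ) - d) (2 * ((j : ℕ) : ℤ) - d) (by rw [e]; congr 1; ring)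
  have h2 := key (2 * ((j : ℕ) : ℤ) - d) (2 * ((i : ℕ) : ℤ) - d) (by rw [e]; congr 1; ring)
  rw [neg_sub] at h1 h2
  rw [h1, h2, add_comm]

lemma IsRacahSequence.consecutive_of_adjacent {q a : F} (hq0 : q ≠ 0)
    (hq : ∀ n : ℕ, 0 < n → q ^ n ≠ 1) (ha : a ≠ 0) {d : ℕ} {θ : Fin (d + 1) → F}
    (hinj : Function.Injective θ) (h : IsRacahSequence q a θ) {i j : Fin (d + 1)}
    (hadj : Adjacent q (θ i) (θ j)) :
    (i : ℕ) + 1 = (j : ℕ) ∨ (j : ℕ) + 1 = (i : ℕ) := by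
  have hq' := zpow_injective_of_not_root_of_unity hq0 hq
  have hi := i.isLt
  have hj := j.isLt
  have hij : i ≠ j := fun e => hadj.1 (congrArg θ e)
  have hij' : (i : ℕ) ≠ j := fun e => hij (Fin.ext e)
  set m : ℤ := (d : ℤ) - 2 * ((i : ℕ) : ℤ) with hm
  set n : ℤ := (d : ℤ) - 2 * ((j : ℕ) : ℤ) with hn
  have hθi : θ i = a * q ^ m + a⁻¹ * (q ^ m)⁻¹ := by rw [h, ← zpow_neg, hm, neg_sub]
  have hθj : θ j = a * q ^ n + a⁻¹ * (q ^ n)⁻¹ := by rw [h, ← zpow_neg, hn, neg_sub]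
  have hqm : q ^ m ≠ 0 := zpow_ne_zero _ hq0
  have hqn : q ^ n ≠ 0 := zpow_ne_zero _ hq0
  -- The adjacency polynomial of θ i and θ j splits into four factors: two express |i - j| = 1, two
  -- prescribe a².
  have hfac : (q ^ m - q ^ 2 * q ^ n) * (q ^ 2 * q ^ m - q ^ n) *
      (a ^ 2 * q ^ m * q ^ n - q ^ 2) * (a ^ 2 * q ^ m * q ^ n * q ^ 2 - 1) = 0 := by
    have := hadj.2
    rw [hθi, hθj] at this
    generalize q ^ m = x at *
    generalize q ^ n = y at *
    field_simp at this
    linear_combination this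
  have hsq : ∀ k : ℤ, a ^ 2 * q ^ m * q ^ n = q ^ k → a ^ 2 = q ^ (k - m - n) := by
    intro k hk
    rw [zpow_sub₀ hq0, zpow_sub₀ hq0, ← hk]
    field_simp
  -- Each such k is a sum of two distinct indices: 0 + k if k ≤ d, and d + (k - d) otherwise.
  have hmid : ∀ k : ℤ, 1 ≤ k → k ≤ 2 * d - 1 → a ^ 2 ≠ q ^ (2 * (k - d)) := by
    intro k hk1 hk2
    rcases le_or_gt k d with hkd | hkd
    · have := h.sq_ne_zpow hq0 ha hinj (i := ⟨0, by omega⟩) (j := ⟨k.toNat, by omega⟩)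
        (by simp; omega)
      simpa [Int.toNat_of_nonneg (by omega : 0 ≤ k)] using this
    · have := h.sq_ne_zpow hq0 ha hinj (i := ⟨d, by omega⟩) (j := ⟨(k - d).toNat, by omega⟩)
        (by simp; omega)
      rw [Int.toNat_of_nonneg (by omega : 0 ≤ k - d)] at this
      simpa using this
  rcases mul_eq_zero.mp hfac with hfac | h4
  · rcases mul_eq_zero.mp hfac with hfac | h3
    · rcases mul_eq_zero.mp hfac with h1 | h2
      · have : q ^ m = q ^ (2 + n) := by
          rw [zpow_add₀ hq0]; exact_mod_cast sub_eq_zero.mp h1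
        have := hq' this
        omega
      · have : q ^ (2 + m) = q ^ n := by
          rw [zpow_add₀ hq0]; exact_mod_cast sub_eq_zero.mp h2
        have := hq' this
        omega
    · have e := hsq 2 (by exact_mod_cast sub_eq_zero.mp h3)
      by_contra hcon
      -- The excluded value k = 2d would need {i, j} = {d - 1, d}, which is already consecutive.
      refine hmid ((i : ℕ) + (j : ℕ) + 1) (by omega) (by omega) ?_
      rw [e]; congr 1; omega
  · have e := hsq (-2) (by
      rw [zpow_neg]
      exact eq_inv_of_mul_eq_one_left (by exact_mod_cast sub_eq_zero.mp h4))
    by_contra hcon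
    refine hmid ((i : ℕ) + (j : ℕ) - 1) (by omega) (by omega) ?_
    rw [e]; congr 1; omega

end eigenvalues

/-! ### Flags, tridiagonal systems and the split decomposition. -/

section flags

variable {F : Type*} [Field F] {V : Type*} [AddCommGroup V] [Module F V]

/-- The sum of the `P j` with `j < n`. -/
def sumBelow {d : ℕ} (P : Fin (d + 1) → Submodule F V) (n : ℕ) : Submodule F V :=
  ⨆ j ∈ {j : Fin (d + 1) | (j : ℕ) < n}, P j

/-- The sum of the `P j` with `n ≤ j`. -/
def sumAbove {d : ℕ} (P : Fin (d + 1) → Submodule F V) (n : ℕ) : Submodule F V :=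
  ⨆ j ∈ {j : Fin (d + 1) | n ≤ (j : ℕ)}, P j

section family

variable {d : ℕ} (P : Fin (d + 1) → Submodule F V)

lemma le_sumBelow {j : Fin (d + 1)} {n : ℕ} (h : (j : ℕ) < n) : P j ≤ sumBelow P n :=
  le_biSup P h

lemma le_sumAbove {j : Fin (d + 1)} {n : ℕ} (h : n ≤ (j : ℕ)) : P j ≤ sumAbove P n :=
  le_biSup P h

lemma sumBelow_mono : Monotone (sumBelow P) := fun _ _ hmn =>
  biSup_mono fun _ hj => lt_of_lt_of_le hj hmn

lemma sumAbove_anti : Antitone (sumAbove P) := fun _ _ hmn =>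
  biSup_mono fun _ hj => le_trans hmn hj

lemma sumBelow_zero : sumBelow P 0 = ⊥ := by simp [sumBelow]

lemma sumAbove_eq_bot {n : ℕ} (hn : d < n) : sumAbove P n = ⊥ :=
  eq_bot_iff.mpr (iSup₂_le fun j hj => by
    have := j.isLt
    simp only [Set.mem_ofPred_eq] at hj
    omega)

lemma sumBelow_eq_top (hP : ⨆ i, P i = ⊤) {n : ℕ} (hn : d < n) : sumBelow P n = ⊤ :=
  top_le_iff.mp (hP.ge.trans (iSup_le fun i => le_sumBelow P (by omega)))

lemma sumAbove_zero (hP : ⨆ i, P i = ⊤) : sumAbove P 0 = ⊤ :=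
  top_le_iff.mp (hP.ge.trans (iSup_le fun _ => le_sumAbove P (Nat.zero_le _)))

lemma iSup_Iic_eq (i : Fin (d + 1)) : ⨆ j ∈ Set.Iic i, P j = sumBelow P (i + 1) := by
  rw [sumBelow]
  congr! 3 with j
  rw [Set.mem_Iic, Set.mem_ofPred_eq, Fin.le_def]
  omega

lemma iSup_Ici_eq (i : Fin (d + 1)) : ⨆ j ∈ Set.Ici i, P j = sumAbove P i := by
  rw [sumAbove]
  congr! 3 with j

lemma sumBelow_succ (i : Fin (d + 1)) : sumBelow P (i + 1) = sumBelow P i ⊔ P i := by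
  refine le_antisymm (iSup₂_le fun j hj => ?_)
    (sup_le (sumBelow_mono P (Nat.le_succ _)) (le_sumBelow P (Nat.lt_succ_self _)))
  simp only [Set.mem_ofPred_eq] at hj
  rcases Nat.lt_succ_iff_lt_or_eq.mp hj with h | h
  · exact (le_sumBelow P h).trans le_sup_left
  · rw [Fin.ext h]
    exact le_sup_right

lemma disjoint_sumBelow_sumAbove (hP : iSupIndep P) (n : ℕ) :
    Disjoint (sumBelow P n) (sumAbove P n) :=
  hP.disjoint_biSup_biSup (Set.disjoint_left.mpr fun j hj hj' => by
    simp only [Set.mem_ofPred_eq] at hj hj'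
    omega)

end family

section eigenspaces

variable {X : Module.End F V} {d : ℕ} {θ : Fin (d + 1) → F}

lemma mem_biSup_eigenspace_apply {S : Set (Fin (d + 1))} {v : V}
    (hv : v ∈ ⨆ j ∈ S, eigenspace X (θ j)) (i : Fin (d + 1)) :
    X v - θ i • v ∈ ⨆ j ∈ S \ {i}, eigenspace X (θ j) := by
  suffices h : ⨆ j ∈ S, eigenspace X (θ j) ≤
      (⨆ j ∈ S \ {i}, eigenspace X (θ j)).comap (X - θ i • 1) from h hv
  refine iSup₂_le fun j hj v hv => ?_
  rw [Submodule.mem_comap, LinearMap.sub_apply, LinearMap.smul_apply, mem_eigenspace_iff.mp hv,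
    Module.End.one_apply, ← sub_smul]
  by_cases hij : j = i
  · rw [hij, sub_self, zero_smul]
    exact Submodule.zero_mem _
  · exact Submodule.smul_mem _ _ 
      (le_biSup (fun j => eigenspace X (θ j)) (show j ∈ S \ {i} from ⟨hj, hij⟩) hv)

lemma apply_sub_mem_sumBelow {i : Fin (d + 1)} {v : V}
    (hv : v ∈ sumBelow (fun j => eigenspace X (θ j)) (i + 1)) :
    X v - θ i • v ∈ sumBelow (fun j => eigenspace X (θ j)) i := by
  refine (biSup_mono fun j hj => ?_ : (_ : Submodule F V) ≤ _) (mem_biSup_eigenspace_apply hv i)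
  have h1 : (j : ℕ) < i + 1 := hj.1
  have h2 : (j : ℕ) ≠ i := fun e => hj.2 (Fin.ext e)
  change (j : ℕ) < i
  omega

lemma apply_sub_mem_sumAbove {i : Fin (d + 1)} {v : V}
    (hv : v ∈ sumAbove (fun j => eigenspace X (θ j)) i) :
    X v - θ i • v ∈ sumAbove (fun j => eigenspace X (θ j)) (i + 1) := by
  refine (biSup_mono fun j hj => ?_ : (_ : Submodule F V) ≤ _) (mem_biSup_eigenspace_apply hv i)
  have h1 : (i : ℕ) ≤ j := hj.1
  have h2 : (j : ℕ) ≠ i := fun e => hj.2 (Fin.ext e)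
  change (i : ℕ) + 1 ≤ j
  omega

end eigenspaces

section tridiagonal

variable {Y : Module.End F V} {d : ℕ} {P : Fin (d + 1) → Submodule F V}

lemma IsTridiagonalOn.apply_mem_sumBelow (h : IsTridiagonalOn Y P) {n : ℕ} {v : V}
    (hv : v ∈ sumBelow P n) : Y v ∈ sumBelow P (n + 1) := by
  suffices h : sumBelow P n ≤ (sumBelow P (n + 1)).comap Y from h hv
  refine iSup₂_le fun j hj v hv => ?_
  rw [Submodule.mem_comap]
  refine (iSup₂_le fun k hk => ?_ : (_ : Submodule F V) ≤ _) (h j (Submodule.mem_map_of_mem hv))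
  simp only [Set.mem_ofPred_eq] at hj hk
  exact le_sumBelow P (by omega)

lemma IsTridiagonalOn.apply_mem_sumAbove (h : IsTridiagonalOn Y P) {n : ℕ} {v : V}
    (hv : v ∈ sumAbove P (n + 1)) : Y v ∈ sumAbove P n := by
  suffices h : sumAbove P (n + 1) ≤ (sumAbove P n).comap Y from h hv
  refine iSup₂_le fun j hj v hv => ?_
  rw [Submodule.mem_comap]
  refine (iSup₂_le fun k hk => ?_ : (_ : Submodule F V) ≤ _) (h j (Submodule.mem_map_of_mem hv))
  simp only [Set.mem_ofPred_eq] at hj hk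
  exact le_sumAbove P (by omega)

end tridiagonal

/-- Eigenvalue orderings of a tridiagonal pair: each of `A`, `A*` acts on the eigenspaces of the
other one in a tridiagonal fashion. The two eigenvalue lists may a priori differ in length. -/
structure IsTridiagonalSystem (A As : Module.End F V) {d δ : ℕ} (θ : Fin (d + 1) → F)
    (θs : Fin (δ + 1) → F) : Prop where
  irreducible : IsIrreduciblePair A As
  list_A : IsEigenvalueList A θ
  list_As : IsEigenvalueList As θs
  iSup_A : ⨆ i, eigenspace A (θ i) = ⊤
  iSup_As : ⨆ i, eigenspace As (θs i) = ⊤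
  tridiagonal_A : IsTridiagonalOn A fun i => eigenspace As (θs i)
  tridiagonal_As : IsTridiagonalOn As fun i => eigenspace A (θ i)

namespace IsTridiagonalSystem

variable {A As : Module.End F V} {d δ : ℕ} {θ : Fin (d + 1) → F} {θs : Fin (δ + 1) → F}

lemma symm (h : IsTridiagonalSystem A As θ θs) : IsTridiagonalSystem As A θs θ :=
  ⟨h.irreducible.symm, h.list_As, h.list_A, h.iSup_As, h.iSup_A, h.tridiagonal_As,
    h.tridiagonal_A⟩

lemma comp_rev_left (h : IsTridiagonalSystem A As θ θs) :
    IsTridiagonalSystem A As (θ ∘ Fin.rev) θs :=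
  ⟨h.irreducible, h.list_A.comp_rev, h.list_As,
    (Fin.rev_surjective.iSup_comp fun i => eigenspace A (θ i)).trans h.iSup_A,
    h.iSup_As, h.tridiagonal_A, h.tridiagonal_As.comp_rev⟩

lemma comp_rev_right (h : IsTridiagonalSystem A As θ θs) :
    IsTridiagonalSystem A As θ (θs ∘ Fin.rev) := h.symm.comp_rev_left.symm

end IsTridiagonalSystem

/-- The sum of the first `n` eigenspaces of the endomorphism `X`. -/
abbrev eigBelow (X : Module.End F V) {d : ℕ} (θ : Fin (d + 1) → F) (n : ℕ) : Submodule F V :=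
  sumBelow (fun j => eigenspace X (θ j)) n

/-- The sum of all but the first `n` eigenspaces of the endomorphism `X`. -/
abbrev eigAbove (X : Module.End F V) {d : ℕ} (θ : Fin (d + 1) → F) (n : ℕ) : Submodule F V :=
  sumAbove (fun j => eigenspace X (θ j)) n

/-- The `n`-th component of the split decomposition. -/
abbrev splitSpace (A As : Module.End F V) {d δ : ℕ} (θ : Fin (d + 1) → F)
    (θs : Fin (δ + 1) → F) (n : ℕ) : Submodule F V :=
  eigBelow As θs (n + 1) ⊓ eigAbove A θ n

namespace IsTridiagonalSystem

variable {A As : Module.End F V} {d δ : ℕ} {θ : Fin (d + 1) → F} {θs : Fin (δ + 1) → F}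

lemma exists_sub_mem_eigAbove (A : Module.End F V) (θ : Fin (d + 1) → F) (n : ℕ) :
    ∃ c : F, ∀ v ∈ eigAbove A θ n, A v - c • v ∈ eigAbove A θ (n + 1) := by
  by_cases hn : n < d + 1
  · exact ⟨θ ⟨n, hn⟩, fun v hv => apply_sub_mem_sumAbove (i := ⟨n, hn⟩) hv⟩
  · refine ⟨0, fun v hv => ?_⟩
    rw [eigAbove, sumAbove_eq_bot _ (by omega), Submodule.mem_bot] at hv
    simp [hv]

lemma exists_sub_mem_eigBelow (A : Module.End F V) (θ : Fin (d + 1) → F)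
    (hA : ⨆ i, eigenspace A (θ i) = ⊤) (n : ℕ) :
    ∃ c : F, ∀ v ∈ eigBelow A θ (n + 1), A v - c • v ∈ eigBelow A θ n := by
  by_cases hn : n < d + 1
  · exact ⟨θ ⟨n, hn⟩, fun v hv => apply_sub_mem_sumBelow (i := ⟨n, hn⟩) hv⟩
  · refine ⟨0, fun v _ => ?_⟩
    rw [eigBelow, sumBelow_eq_top _ hA (by omega)]
    trivial

/-- The sums `∑ n, (V*_0 + ⋯ + V*_n) ∩ (V_{n+s} + ⋯ + V_d)` are `0` or `V`. -/
lemma iSup_eq_bot_or_eq_top (h : IsTridiagonalSystem A As θ θs) (s : ℕ) :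
    ⨆ n, eigBelow As θs (n + 1) ⊓ eigAbove A θ (n + s) = ⊥ ∨
      ⨆ n, eigBelow As θs (n + 1) ⊓ eigAbove A θ (n + s) = ⊤ := by
  set W : ℕ → Submodule F V := fun n => eigBelow As θs (n + 1) ⊓ eigAbove A θ (n + s) with hW
  have hle : ∀ n, W n ≤ ⨆ n, W n := le_iSup W
  refine h.irreducible _ ?_ ?_
  · suffices hs : ⨆ n, W n ≤ (⨆ n, W n).comap A from hs
    refine iSup_le fun n v hv => ?_
    obtain ⟨c, hc⟩ := exists_sub_mem_eigAbove A θ (n + s)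
    -- A raises the A* flag by one step, while A - c pushes the A flag one step down.
    have h1 : A v - c • v ∈ W (n + 1) := by
      refine ⟨Submodule.sub_mem _ (h.tridiagonal_A.apply_mem_sumBelow hv.1)
        (Submodule.smul_mem _ _ (sumBelow_mono _ (Nat.le_succ _) hv.1)), ?_⟩
      rw [show n + 1 + s = n + s + 1 by ring]
      exact hc v hv.2
    rw [Submodule.mem_comap, ← sub_add_cancel (A v) (c • v)]
    exact Submodule.add_mem _ (hle _ h1) (Submodule.smul_mem _ _ (hle n hv))
  · suffices hs : ⨆ n, W n ≤ (⨆ n, W n).comap As from hs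
    refine iSup_le fun n v hv => ?_
    obtain ⟨c, hc⟩ := exists_sub_mem_eigBelow As θs h.iSup_As n
    have h1 := hc v hv.1
    have h2 : As v - c • v ∈ ⨆ n, W n := by
      cases n with
      | zero =>
        rw [eigBelow, sumBelow_zero, Submodule.mem_bot] at h1
        rw [h1]
        exact Submodule.zero_mem _
      | succ k =>
        refine hle k ⟨h1, ?_⟩
        have hv2 : v ∈ eigAbove A θ (k + s + 1) := by
          have := hv.2
          rwa [show k + 1 + s = k + s + 1 by ring] at this
        exact Submodule.sub_mem _ (h.tridiagonal_As.apply_mem_sumAbove hv2)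
          (Submodule.smul_mem _ _ (sumAbove_anti _ (Nat.le_succ _) hv2))
    rw [Submodule.mem_comap, ← sub_add_cancel (As v) (c • v)]
    exact Submodule.add_mem _ h2 (Submodule.smul_mem _ _ (hle n hv))

/-- With shift 1 the stable sum lies in V_1 + ⋯ + V_d, a proper subspace, so it is 0. -/
lemma disjoint (h : IsTridiagonalSystem A As θ θs) (n : ℕ) :
    Disjoint (eigBelow As θs n) (eigAbove A θ n) := by
  cases n with
  | zero => rw [eigBelow, sumBelow_zero]; exact disjoint_bot_left
  | succ n =>
    have hbot : ⨆ n, eigBelow As θs (n + 1) ⊓ eigAbove A θ (n + 1) = ⊥ := by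
      refine (h.iSup_eq_bot_or_eq_top 1).resolve_right fun htop => ?_
      have h1 : eigAbove A θ 1 = ⊤ := top_le_iff.mp (htop.ge.trans (iSup_le fun n =>
        inf_le_right.trans (sumAbove_anti _ (by omega))))
      have h2 : Disjoint _ (eigAbove A θ 1) := disjoint_sumBelow_sumAbove _ h.list_A.iSupIndep 1
      rw [h1, disjoint_top] at h2
      exact h.list_A.ne_bot 0 (le_bot_iff.mp
        ((le_sumBelow (fun i => eigenspace A (θ i)) (by simp)).trans h2.le))
    rw [disjoint_iff, ← le_bot_iff, ← hbot]
    exact le_iSup (fun n => eigBelow As θs (n + 1) ⊓ eigAbove A θ (n + 1)) n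

/-- If δ < d, the first d eigenspaces of A* already fill V, yet they must be disjoint from V_d. -/
lemma le_length (h : IsTridiagonalSystem A As θ θs) : d ≤ δ := by
  by_contra! hlt
  have := h.disjoint d
  rw [eigBelow, sumBelow_eq_top _ h.iSup_As hlt, top_disjoint] at this
  exact h.list_A.ne_bot (Fin.last d) (le_bot_iff.mp
    ((le_sumAbove (fun i => eigenspace A (θ i)) (by simp)).trans this.le))

lemma length_eq (h : IsTridiagonalSystem A As θ θs) : d = δ :=
  le_antisymm h.le_length h.symm.le_length

end IsTridiagonalSystem

namespace IsTridiagonalSystem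

variable {A As : Module.End F V} {d : ℕ} {θ θs : Fin (d + 1) → F}

/-- With shift 0 the stable sum contains V_d, as its term of index d, so it is not 0. -/
lemma iSup_splitSpace (h : IsTridiagonalSystem A As θ θs) :
    ⨆ n, splitSpace A As θ θs n = ⊤ := by
  refine (h.iSup_eq_bot_or_eq_top 0).resolve_left fun hbot => ?_
  have : splitSpace A As θ θs d ≤ ⊥ :=
    (le_iSup (fun n => splitSpace A As θ θs n) d).trans hbot.le
  rw [splitSpace, eigBelow, sumBelow_eq_top _ h.iSup_As (Nat.lt_succ_self _), top_inf_eq] at this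
  exact h.list_A.ne_bot (Fin.last d) (le_bot_iff.mp
    ((le_sumAbove (fun i => eigenspace A (θ i)) (by simp)).trans this))

lemma codisjoint (h : IsTridiagonalSystem A As θ θs) (n : ℕ) :
    Codisjoint (eigBelow As θs n) (eigAbove A θ n) := by
  rw [codisjoint_iff, ← top_le_iff, ← h.iSup_splitSpace]
  refine iSup_le fun m => ?_
  rcases lt_or_ge m n with hmn | hmn
  · exact inf_le_left.trans ((sumBelow_mono _ hmn).trans le_sup_left)
  · exact inf_le_right.trans ((sumAbove_anti _ hmn).trans le_sup_right)

lemma splitSpace_eq_bot (A As : Module.End F V) (θ θs : Fin (d + 1) → F) {n : ℕ} (hn : d < n) :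
    splitSpace A As θ θs n = ⊥ := by
  rw [splitSpace, eigAbove, sumAbove_eq_bot _ hn, inf_bot_eq]

lemma iSup_fin_splitSpace (h : IsTridiagonalSystem A As θ θs) :
    ⨆ i : Fin (d + 1), splitSpace A As θ θs i = ⊤ := by
  rw [← top_le_iff, ← h.iSup_splitSpace]
  refine iSup_le fun n => ?_
  by_cases hn : n < d + 1
  · exact le_iSup (fun i : Fin (d + 1) => splitSpace A As θ θs i) ⟨n, hn⟩
  · rw [splitSpace_eq_bot _ _ _ _ (by omega)]
    exact bot_le

/-- The other components lie in flag pieces below i and above i + 1; disjointness at i + 1 removes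
the upper part, disjointness at i the lower one. -/
lemma iSupIndep_splitSpace (h : IsTridiagonalSystem A As θ θs) :
    iSupIndep fun i : Fin (d + 1) => splitSpace A As θ θs i := by
  intro i
  have hle : (⨆ j, ⨆ (_ : j ≠ i), splitSpace A As θ θs j) ≤
      eigBelow As θs i ⊔ eigAbove A θ (i + 1) := by
    refine iSup₂_le fun j hj => ?_
    have hj' : (j : ℕ) ≠ i := fun e => hj (Fin.ext e)
    rcases lt_or_gt_of_ne hj' with hji | hji
    · exact inf_le_left.trans ((sumBelow_mono _ hji).trans le_sup_left)
    · exact inf_le_right.trans ((sumAbove_anti _ hji).trans le_sup_right)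
  refine Disjoint.mono_right hle ?_
  rw [Submodule.disjoint_def]
  rintro w hw hw'
  obtain ⟨x, hx, y, hy, rfl⟩ := Submodule.mem_sup.mp hw'
  have hy0 : y = 0 := by
    refine Submodule.disjoint_def.mp (h.disjoint (i + 1)) y ?_ hy
    have := Submodule.sub_mem _ hw.1 (sumBelow_mono _ (Nat.le_succ _) hx)
    rwa [add_sub_cancel_left] at this
  rw [hy0, add_zero] at hw ⊢
  exact Submodule.disjoint_def.mp (h.disjoint i) x hx hw.2

lemma eigBelow_succ (h : IsTridiagonalSystem A As θ θs) (n : ℕ) :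
    eigBelow As θs (n + 1) = eigBelow As θs n ⊔ splitSpace A As θ θs n := by
  rw [splitSpace, inf_comm, ← sup_inf_assoc_of_le _ (sumBelow_mono _ (Nat.le_succ _)),
    (h.codisjoint n).eq_top, top_inf_eq]

lemma sumBelow_splitSpace (h : IsTridiagonalSystem A As θ θs) {n : ℕ} (hn : n ≤ d + 1) :
    sumBelow (fun i : Fin (d + 1) => splitSpace A As θ θs i) n = eigBelow As θs n := by
  induction n with
  | zero => rw [sumBelow_zero, eigBelow, sumBelow_zero]
  | succ n ih =>
    rw [h.eigBelow_succ, ← ih (by omega)]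
    exact sumBelow_succ (fun i : Fin (d + 1) => splitSpace A As θ θs i) ⟨n, by omega⟩

/-- Both sides complement the same piece of the A* flag and one contains the other, so the modular
law gives equality. -/
lemma sumAbove_splitSpace (h : IsTridiagonalSystem A As θ θs) (n : ℕ) :
    sumAbove (fun i : Fin (d + 1) => splitSpace A As θ θs i) n = eigAbove A θ n := by
  have hle : sumAbove (fun i : Fin (d + 1) => splitSpace A As θ θs i) n ≤ eigAbove A θ n :=
    iSup₂_le fun j hj => inf_le_right.trans (sumAbove_anti _ hj)
  refine le_antisymm hle ?_
  have htop : eigBelow As θs n ⊔ sumAbove (fun i : Fin (d + 1) => splitSpace A As θ θs i) n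
      = ⊤ := by
    rw [← top_le_iff, ← h.iSup_fin_splitSpace]
    refine iSup_le fun m => ?_
    rcases lt_or_ge (m : ℕ) n with hmn | hmn
    · exact inf_le_left.trans ((sumBelow_mono _ hmn).trans le_sup_left)
    · exact (le_sumAbove (fun i : Fin (d + 1) => splitSpace A As θ θs i) hmn).trans le_sup_right
  calc eigAbove A θ n = (sumAbove (fun i : Fin (d + 1) => splitSpace A As θ θs i) n ⊔
        eigBelow As θs n) ⊓ eigAbove A θ n := by rw [sup_comm, htop, top_inf_eq]
    _ ≤ _ := by rw [sup_inf_assoc_of_le _ hle, (h.disjoint n).eq_bot, sup_bot_eq]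

/-- A zero component would make the A* flag stall at i, putting V*_i inside the earlier eigenspaces.
-/
lemma isDecomposition_splitSpace (h : IsTridiagonalSystem A As θ θs) :
    IsDecomposition fun i : Fin (d + 1) => splitSpace A As θ θs i := by
  refine ⟨fun i hi => ?_, (DirectSum.isInternal_submodule_iff_iSupIndep_and_iSup_eq_top _).mpr
    ⟨h.iSupIndep_splitSpace, h.iSup_fin_splitSpace⟩⟩
  have h1 := h.eigBelow_succ i
  rw [hi, sup_bot_eq] at h1
  have h2 := h.list_As.iSupIndep.disjoint_biSup (x := i) (y := {j | (j : ℕ) < i}) (by simp)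
  have h3 : eigenspace As (θs i) ≤ eigBelow As θs i := by
    rw [← h1]
    exact le_sumBelow (fun j => eigenspace As (θs j)) (Nat.lt_succ_self _)
  exact h.list_As.ne_bot i (le_bot_iff.mp (h2 le_rfl h3))

end IsTridiagonalSystem

/-- This gives uniqueness of the split decomposition: a spanning family inside an independent one
must fill it. -/
lemma eq_of_le_of_iSupIndep {ι : Type*} {W W' : ι → Submodule F V} (hle : ∀ i, W i ≤ W' i)
    (hW : ⨆ i, W i = ⊤) (hW' : iSupIndep W') (i : ι) : W i = W' i := by
  refine le_antisymm (hle i) ?_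
  have htop : W i ⊔ (⨆ j, ⨆ (_ : j ≠ i), W' j) = ⊤ := by
    rw [← top_le_iff, ← hW]
    refine iSup_le fun j => ?_
    by_cases hj : j = i
    · rw [hj]; exact le_sup_left
    · exact (hle j).trans ((le_iSup₂ (f := fun j (_ : j ≠ i) => W' j) j hj).trans le_sup_right)
  calc W' i = (W i ⊔ ⨆ j, ⨆ (_ : j ≠ i), W' j) ⊓ W' i := by rw [htop, top_inf_eq]
    _ ≤ W i := by
      rw [sup_inf_assoc_of_le _ (hle i), inf_comm, (hW' i).eq_bot, sup_bot_eq]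

lemma exists_isCorrespondingMap (q : F) {d : ℕ} {W : Fin (d + 1) → Submodule F V}
    (hW : IsDecomposition W) : ∃ X, IsCorrespondingMap q W X := by
  let e := LinearEquiv.ofBijective (DirectSum.coeLinearMap W) hW.internal
  refine ⟨(DirectSum.toModule F _ V fun i : Fin (d + 1) =>
    q ^ ((d : ℤ) - 2 * ((i : ℕ) : ℤ)) • (W i).subtype) ∘ₗ e.symm.toLinearMap, fun i w hw => ?_⟩
  have : e.symm w = DirectSum.lof F _ (fun i => W i) i ⟨w, hw⟩ := by
    rw [LinearEquiv.symm_apply_eq]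
    exact (DirectSum.coeLinearMap_lof W i ⟨w, hw⟩).symm
  rw [LinearMap.comp_apply, LinearEquiv.coe_coe, this, DirectSum.toModule_lof]
  rfl

namespace IsTridiagonalSystem

variable {A As : Module.End F V} {d : ℕ} {θ θs : Fin (d + 1) → F}

lemma exists_isSplitMap (q : F) (h : IsTridiagonalSystem A As θ θs) :
    ∃ K, IsSplitMap q (fun i => eigenspace As (θs i)) (fun i => eigenspace A (θ i)) K := by
  obtain ⟨K, hK⟩ := exists_isCorrespondingMap q h.isDecomposition_splitSpace
  refine ⟨K, _, h.isDecomposition_splitSpace, fun i => ?_, fun i => ?_, hK⟩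
  · have hi := i.isLt
    rw [iSup_Iic_eq, iSup_Iic_eq, h.sumBelow_splitSpace (by omega)]
  · rw [iSup_Ici_eq, iSup_Ici_eq, h.sumAbove_splitSpace]

/-- A split map acts as a scalar on the components of the split decomposition. -/
lemma apply_of_mem_splitSpace {q : F} (h : IsTridiagonalSystem A As θ θs) {K : Module.End F V}
    (hK : IsSplitMap q (fun i => eigenspace As (θs i)) (fun i => eigenspace A (θ i)) K) {n : ℕ}
    {w : V} (hw : w ∈ splitSpace A As θ θs n) : K w = q ^ ((d : ℤ) - 2 * (n : ℤ)) • w := by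
  by_cases hn : n < d + 1
  · obtain ⟨W, hW, h1, h2, h3⟩ := hK
    -- The two flag conditions already force each W i into the intersection.
    have hle : ∀ i : Fin (d + 1), W i ≤ splitSpace A As θ θs i := fun i => by
      refine le_inf ?_ ?_
      · have := h1 i
        rw [iSup_Iic_eq, iSup_Iic_eq] at this
        rw [eigBelow, ← this]
        exact le_sumBelow W (Nat.lt_succ_self _)
      · have := h2 i
        rw [iSup_Ici_eq, iSup_Ici_eq] at this
        rw [eigAbove, ← this]
        exact le_sumAbove W le_rfl
    have hint := (DirectSum.isInternal_submodule_iff_iSupIndep_and_iSup_eq_top _).mp hW.internal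
    have heq := eq_of_le_of_iSupIndep hle hint.2 h.iSupIndep_splitSpace ⟨n, hn⟩
    exact h3 ⟨n, hn⟩ w (heq ▸ hw)
  · rw [splitSpace_eq_bot _ _ _ _ (by omega), Submodule.mem_bot] at hw
    simp [hw]

lemma apply_A_mem_splitSpace (h : IsTridiagonalSystem A As θ θs) {i : Fin (d + 1)} {w : V}
    (hw : w ∈ splitSpace A As θ θs i) :
    A w - θ i • w ∈ splitSpace A As θ θs (i + 1) :=
  ⟨Submodule.sub_mem _ (h.tridiagonal_A.apply_mem_sumBelow hw.1)
    (Submodule.smul_mem _ _ (sumBelow_mono _ (Nat.le_succ _) hw.1)),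
    apply_sub_mem_sumAbove hw.2⟩

lemma apply_As_mem_splitSpace (h : IsTridiagonalSystem A As θ θs) {i : Fin (d + 1)} {w : V}
    (hw : w ∈ splitSpace A As θ θs i) {n : ℕ} (hn : n + 1 = (i : ℕ)) :
    As w - θs i • w ∈ splitSpace A As θ θs n := by
  have h1 := apply_sub_mem_sumBelow hw.1
  have h2 := hw.2
  rw [← hn] at h1 h2
  exact ⟨h1, Submodule.sub_mem _ (h.tridiagonal_As.apply_mem_sumAbove h2)
    (Submodule.smul_mem _ _ (sumAbove_anti _ (Nat.le_succ _) h2))⟩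

end IsTridiagonalSystem

end flags

/-! ### Identities between the split maps and the generators. -/

section algebra

variable {F : Type*} [Field F] {R : Type*} [Ring R] [Algebra F R]

/-- The quadratic expression in `K`, `B` that vanishes for the maps attached to two split
decompositions. -/
def quadraticDefect (q a : F) (K B : R) : R :=
  a • (K * K) - ((a⁻¹ * q - a * q⁻¹) / (q - q⁻¹)) • (K * B)
    - ((a * q - a⁻¹ * q⁻¹) / (q - q⁻¹)) • (B * K) + a⁻¹ • (B * B)

/-- The relation `[K, A]_q = (q - q⁻¹) (a K² + a⁻¹)`. -/
def QuadraticWeyl (q a : F) (K A : R) : Prop :=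
  qComm q K A = (q - q⁻¹) • (a • (K * K) + a⁻¹ • (1 : R))

lemma sq_sub_one_ne_zero {q : F} (hq0 : q ≠ 0) (hq2 : q - q⁻¹ ≠ 0) : q ^ 2 - 1 ≠ 0 := by
  intro h
  apply hq2
  rw [show q - q⁻¹ = q⁻¹ * (q ^ 2 - 1) by field_simp, h, mul_zero]

lemma quadraticDefect_swap (q a : F) (K B : R) :
    quadraticDefect q a⁻¹ B K = quadraticDefect q a K B := by
  simp only [quadraticDefect, inv_inv]
  abel

lemma QuadraticWeyl.mul_eq {q a : F} (hq0 : q ≠ 0) {K A : R} (h : QuadraticWeyl q a K A) :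
    K * A = (q ^ 2)⁻¹ • (A * K) + (1 - (q ^ 2)⁻¹) • (a • (K * K) + a⁻¹ • (1 : R)) := by
  have h' : q⁻¹ • qComm q K A = q⁻¹ • (q - q⁻¹) • (a • (K * K) + a⁻¹ • (1 : R)) := by rw [h]
  rw [qComm] at h'
  linear_combination (norm := skip) h'
  match_scalars <;> field_simp <;> ring

lemma QuadraticWeyl.inverse {q a : F} {K Ki A : R} (h : QuadraticWeyl q a K A) (h1 : K * Ki = 1)
    (h2 : Ki * K = 1) : QuadraticWeyl q⁻¹ a⁻¹ Ki A := by
  have e : Ki * qComm q K A * Ki = Ki * ((q - q⁻¹) • (a • (K * K) + a⁻¹ • (1 : R))) * Ki := by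
    rw [h]
  have e1 : Ki * (K * A) * Ki = A * Ki := by rw [← mul_assoc Ki, h2, one_mul]
  have e2 : Ki * (A * K) * Ki = Ki * A := by rw [mul_assoc, mul_assoc, h1, mul_one]
  have e3 : Ki * (K * K) * Ki = 1 := by rw [← mul_assoc Ki, h2, one_mul, h1]
  simp only [qComm, mul_sub, sub_mul, mul_add, add_mul, mul_smul_comm, smul_mul_assoc, e1, e2, e3,
    mul_one] at e
  rw [QuadraticWeyl, qComm]
  simp only [inv_inv]
  linear_combination (norm := skip) -e
  match_scalars <;> ring

/-- Moving A to the left through D leaves words in K and B. The mixed coefficients of D are such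
that the words of degree one cancel, and the cubic ones regroup as multiples of D. -/
lemma quadraticDefect_mul {q a : F} (hq0 : q ≠ 0) (hq2 : q - q⁻¹ ≠ 0) (ha : a ≠ 0)
    (ha2 : a - a⁻¹ ≠ 0) {K B A : R} (hK : QuadraticWeyl q a K A) (hB : QuadraticWeyl q a⁻¹ B A) :
    ∃ x y z w : F, quadraticDefect q a K B * A = ((q ^ 2)⁻¹) ^ 2 • (A * quadraticDefect q a K B)
      + (x • K + y • B) * quadraticDefect q a K B
      + quadraticDefect q a K B * (z • K + w • B) := by
  have hq2' : q ^ 2 - 1 ≠ 0 := sq_sub_one_ne_zero hq0 hq2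
  have ha2' : a ^ 2 - 1 ≠ 0 := sq_sub_one_ne_zero ha ha2
  have eK := hK.mul_eq hq0
  have eB := hB.mul_eq hq0
  have eKK : K * (K * A) = _ := congrArg (K * ·) eK
  have eKB : K * (B * A) = _ := congrArg (K * ·) eB
  have eBK : B * (K * A) = _ := congrArg (B * ·) eK
  have eBB : B * (B * A) = _ := congrArg (B * ·) eB
  simp only [mul_add, mul_smul_comm, ← mul_assoc, mul_one] at eKK eKB eBK eBB
  simp only [eK, eB, add_mul, smul_mul_assoc, smul_add, smul_smul, one_mul] at eKK eKB eBK eBB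
  refine ⟨(1 - (q ^ 2)⁻¹) * ((a ^ 2 * (q ^ 2)⁻¹ - 1) / (a - a⁻¹)),
    (1 - (q ^ 2)⁻¹) * ((1 - (q ^ 2)⁻¹ * (a ^ 2)⁻¹) / (a - a⁻¹)),
    (1 - (q ^ 2)⁻¹) * ((a ^ 2 - (q ^ 2)⁻¹) / (a - a⁻¹)),
    (1 - (q ^ 2)⁻¹) * (((q ^ 2)⁻¹ - (a ^ 2)⁻¹) / (a - a⁻¹)), ?_⟩
  simp only [quadraticDefect, add_mul, sub_mul, mul_add, mul_sub, smul_mul_assoc, mul_smul_comm,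
    smul_add, smul_sub, smul_smul, ← mul_assoc, eKK, eKB, eBK, eBB]
  match_scalars <;> field_simp <;> ring

/-- The analogue for A*: q is inverted, and K and B carry the same scalar b because they share the
A* flag. -/
lemma quadraticDefect_mul_dual {q a b : F} (hq0 : q ≠ 0) (hq2 : q - q⁻¹ ≠ 0) (ha : a ≠ 0)
    (ha2 : a - a⁻¹ ≠ 0) {K B A : R} (hb : b ≠ 0) (hK : QuadraticWeyl q⁻¹ b K A)
    (hB : QuadraticWeyl q⁻¹ b B A) :
    ∃ x y z w : F, quadraticDefect q a K B * A
      = ((q⁻¹ ^ 2)⁻¹) ^ 2 • (A * quadraticDefect q a K B)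
      + (x • K + y • B) * quadraticDefect q a K B
      + quadraticDefect q a K B * (z • K + w • B) := by
  have hq2' : q ^ 2 - 1 ≠ 0 := sq_sub_one_ne_zero hq0 hq2
  have ha2' : a ^ 2 - 1 ≠ 0 := sq_sub_one_ne_zero ha ha2
  have eK := hK.mul_eq (inv_ne_zero hq0)
  have eB := hB.mul_eq (inv_ne_zero hq0)
  have eKK : K * (K * A) = _ := congrArg (K * ·) eK
  have eKB : K * (B * A) = _ := congrArg (K * ·) eB
  have eBK : B * (K * A) = _ := congrArg (B * ·) eK
  have eBB : B * (B * A) = _ := congrArg (B * ·) eB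
  simp only [mul_add, mul_smul_comm, ← mul_assoc, mul_one] at eKK eKB eBK eBB
  simp only [eK, eB, add_mul, smul_mul_assoc, smul_add, smul_smul, one_mul] at eKK eKB eBK eBB
  refine ⟨b * (1 - q ^ 2) * ((a - a⁻¹ * q ^ 2) / (a - a⁻¹)),
    b * (1 - q ^ 2) * ((a * q ^ 2 - a⁻¹) / (a - a⁻¹)),
    b * (1 - q ^ 2) * ((a * q ^ 2 - a⁻¹) / (a - a⁻¹)),
    b * (1 - q ^ 2) * ((a - a⁻¹ * q ^ 2) / (a - a⁻¹)), ?_⟩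
  simp only [quadraticDefect, add_mul, sub_mul, mul_add, mul_sub, smul_mul_assoc, mul_smul_comm,
    smul_add, smul_sub, smul_smul, ← mul_assoc, eKK, eKB, eBK, eBB]
  match_scalars <;> field_simp <;> ring

lemma quadraticDefect_inverse [IsDedekindFiniteMonoid R] {q a : F} (hq0 : q ≠ 0)
    (hq2 : q - q⁻¹ ≠ 0) (ha : a ≠ 0) (ha2 : a - a⁻¹ ≠ 0) {K Ki B Bi : R} (hK1 : K * Ki = 1)
    (hK2 : Ki * K = 1) (hB1 : B * Bi = 1) (hB2 : Bi * B = 1) (h : quadraticDefect q a K B = 0) :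
    quadraticDefect q⁻¹ a⁻¹ Ki Bi = 0 := by
  have hq2' : q ^ 2 - 1 ≠ 0 := sq_sub_one_ne_zero hq0 hq2
  have ha2' : a ^ 2 - 1 ≠ 0 := sq_sub_one_ne_zero ha ha2
  have hK1' : ∀ x : R, K * (Ki * x) = x := fun x => by rw [← mul_assoc, hK1, one_mul]
  have hK2' : ∀ x : R, Ki * (K * x) = x := fun x => by rw [← mul_assoc, hK2, one_mul]
  have hB1' : ∀ x : R, B * (Bi * x) = x := fun x => by rw [← mul_assoc, hB1, one_mul]
  have hB2' : ∀ x : R, Bi * (B * x) = x := fun x => by rw [← mul_assoc, hB2, one_mul]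
  -- Then S T = K⁻²B², so K⁻²D is a polynomial in S and T that factors up to a constant: (S - ac)(T
  -- - ae) = κ.
  obtain ⟨T, hT⟩ : ∃ T, T = Ki * B := ⟨_, rfl⟩
  obtain ⟨S, hS⟩ : ∃ S, S = Ki * (Ki * (B * K)) := ⟨_, rfl⟩
  obtain ⟨c, hc⟩ : ∃ c, c = (a⁻¹ * q - a * q⁻¹) / (q - q⁻¹) := ⟨_, rfl⟩
  obtain ⟨e, he⟩ : ∃ e, e = (a * q - a⁻¹ * q⁻¹) / (q - q⁻¹) := ⟨_, rfl⟩
  obtain ⟨κ, hκ⟩ : ∃ κ, κ = a ^ 2 * (c * e - 1) := ⟨_, rfl⟩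
  have hκ0 : κ ≠ 0 := by
    have : κ = -(a ^ 2 * ((a - a⁻¹) / (q - q⁻¹)) ^ 2) := by
      rw [hκ, hc, he]
      field_simp
      ring
    rw [this]
    exact neg_ne_zero.mpr (mul_ne_zero (pow_ne_zero _ ha) (pow_ne_zero _ (div_ne_zero ha2 hq2)))
  have h1 : a • (1 : R) - c • T - e • S + a⁻¹ • (S * T) = 0 := by
    have h0 : Ki * (Ki * quadraticDefect q a K B) = 0 := by rw [h, mul_zero, mul_zero]
    rw [quadraticDefect, ← hc, ← he] at h0
    simp only [mul_add, mul_sub, mul_smul_comm, hK2', hK2] at h0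
    rw [← h0, hT, hS]
    simp only [mul_assoc, hK1']
  have h2 : (κ⁻¹ • (S - (a * c) • (1 : R))) * (T - (a * e) • (1 : R)) = 1 := by
    have : (S - (a * c) • (1 : R)) * (T - (a * e) • (1 : R)) = κ • (1 : R) := by
      simp only [sub_mul, mul_sub, smul_mul_assoc, mul_smul_comm, one_mul, mul_one]
      linear_combination (norm := skip) a • h1
      rw [hκ]
      match_scalars <;> field_simp <;> ring
    rw [smul_mul_assoc, this, smul_smul, inv_mul_cancel₀ hκ0, one_smul]
  -- As κ ≠ 0, Dedekind finiteness lets the two factors be exchanged.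
  have h3 := mul_eq_one_symm h2
  have h4 : (T - (a * e) • (1 : R)) * (S - (a * c) • (1 : R)) = κ • (1 : R) := by
    rw [mul_smul_comm] at h3
    have := congrArg (κ • ·) h3
    simpa only [smul_smul, mul_inv_cancel₀ hκ0, one_smul] using this
  -- Multiplying by B⁻¹K on the left and K⁻¹B⁻¹ on the right turns TS, T, S, 1 into K⁻², K⁻¹B⁻¹,
  -- B⁻¹K⁻¹, B⁻².
  have h5 : a⁻¹ • (Bi * (K * (((T - (a * e) • (1 : R)) * (S - (a * c) • (1 : R))) * (Ki * Bi)))) =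
    a⁻¹ • (Bi * (K * ((κ • (1 : R)) * (Ki * Bi)))) := by rw [h4]
  rw [hT, hS] at h5
  simp only [mul_sub, sub_mul, mul_smul_comm, smul_mul_assoc, mul_assoc, hK1', hB2', hB1,
    mul_one, one_mul] at h5
  have hc' : (a⁻¹⁻¹ * q⁻¹ - a⁻¹ * q⁻¹⁻¹) / (q⁻¹ - q⁻¹⁻¹) = c := by
    rw [hc, inv_inv, inv_inv, ← neg_sub (a⁻¹ * q), ← neg_sub q, neg_div_neg_eq]
  have he' : (a⁻¹ * q⁻¹ - a⁻¹⁻¹ * q⁻¹⁻¹) / (q⁻¹ - q⁻¹⁻¹) = e := by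
    rw [he, inv_inv, inv_inv, ← neg_sub (a * q), ← neg_sub q, neg_div_neg_eq]
  rw [quadraticDefect, hc', he', inv_inv]
  linear_combination (norm := skip) h5
  rw [hκ]
  match_scalars <;> field_simp <;> ring

end algebra

/-! ### Equitable triples and vanishing of the quadratic expression. -/

section equitable

variable {F : Type*} [Field F] {V : Type*} [AddCommGroup V] [Module F V]

lemma IsEquitable.reverse {q : F} {X Y Z : Module.End F V} (h : IsEquitable q⁻¹ X Y Z) :
    IsEquitable q Z Y X := by
  have key : ∀ {S T : Module.End F V}, QWeyl q⁻¹ S T → QWeyl q T S := by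
    intro S T h
    rw [QWeyl] at h ⊢
    rw [← h, qComm, qComm, inv_inv, ← neg_sub q q⁻¹, inv_neg, neg_smul, ← smul_neg, neg_sub]
  exact ⟨h.isUnit_Z, h.isUnit_Y, h.isUnit_X, key h.weyl_YZ, key h.weyl_XY, key h.weyl_ZX⟩

lemma mapM_swap (a : F) (K B : Module.End F V) : mapM a⁻¹ B K = mapM a K B := by
  rw [mapM, mapM, inv_inv, ← neg_sub a a⁻¹, inv_neg, neg_smul, ← smul_neg, neg_sub]

lemma mapM_inverse (a : F) (K B : Module.End F V) :
    mapM a⁻¹ (Ring.inverse K) (Ring.inverse B) = mapN a K B := by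
  rw [mapM, mapN, inv_inv]

lemma mapN_eq {a : F} {K B : Module.End F V} (hK : IsUnit K) (hB : IsUnit B) :
    mapN a K B = Ring.inverse K * mapM a K B * Ring.inverse B := by
  simp only [mapM, mapN, mul_sub, sub_mul, mul_smul_comm, smul_mul_assoc,
    Ring.inverse_mul_cancel K hK, one_mul]
  rw [mul_assoc, Ring.mul_inverse_cancel B hB, mul_one, ← neg_sub a a⁻¹, inv_neg, neg_smul,
    ← smul_neg, neg_sub]

/-- Multiplication by M⁻¹ on both sides trades an inverse for a relation quadratic in M, to which
linear algebra in K, B, A applies. -/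
lemma qComm_inverse_right {q : F} {M X : Module.End F V} (hM : IsUnit M)
    (h : qComm q M X = (q - q⁻¹) • (M * M)) :
    qComm q X (Ring.inverse M) = (q - q⁻¹) • (1 : Module.End F V) := by
  have h1 := Ring.mul_inverse_cancel M hM
  have h2 := Ring.inverse_mul_cancel M hM
  have e : Ring.inverse M * qComm q M X * Ring.inverse M =
      Ring.inverse M * ((q - q⁻¹) • (M * M)) * Ring.inverse M := by rw [h]
  simp only [qComm, mul_sub, sub_mul, mul_smul_comm, smul_mul_assoc, mul_assoc, h1, mul_one] at e
  simp only [← mul_assoc, h2, one_mul] at e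
  exact e

lemma qComm_inverse_left {q : F} {M X : Module.End F V} (hM : IsUnit M)
    (h : qComm q X M = (q - q⁻¹) • (M * M)) :
    qComm q (Ring.inverse M) X = (q - q⁻¹) • (1 : Module.End F V) := by
  have h1 := Ring.mul_inverse_cancel M hM
  have h2 := Ring.inverse_mul_cancel M hM
  have e : Ring.inverse M * qComm q X M * Ring.inverse M =
      Ring.inverse M * ((q - q⁻¹) • (M * M)) * Ring.inverse M := by rw [h]
  simp only [qComm, mul_sub, sub_mul, mul_smul_comm, smul_mul_assoc, mul_assoc, h1, mul_one] at e
  simp only [← mul_assoc, h2, one_mul] at e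
  exact e

lemma qWeyl_of_qComm {q : F} (hq2 : q - q⁻¹ ≠ 0) {X Y : Module.End F V}
    (h : qComm q X Y = (q - q⁻¹) • (1 : Module.End F V)) : QWeyl q X Y := by
  rw [QWeyl, h, smul_smul, inv_mul_cancel₀ hq2, one_smul]

/-- The relation of K with X needs only `hK`, that of M⁻¹ with K only D = 0, and that of X with M⁻¹
uses all three. -/
lemma isEquitable_of_quadraticDefect_eq_zero {q a : F} (hq0 : q ≠ 0) (hq2 : q - q⁻¹ ≠ 0)
    (ha : a ≠ 0) (ha2 : a - a⁻¹ ≠ 0) {A K B : Module.End F V} (hK : QuadraticWeyl q a K A)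
    (hB : QuadraticWeyl q a⁻¹ B A) (hL : quadraticDefect q a K B = 0) (uK : IsUnit K)
    (uM : IsUnit (mapM a K B)) (uX : IsUnit (a • A - a ^ 2 • K)) :
    IsEquitable q (a • A - a ^ 2 • K) (Ring.inverse (mapM a K B)) K := by
  have hq2' := sq_sub_one_ne_zero hq0 hq2
  have ha2' := sq_sub_one_ne_zero ha ha2
  simp only [QuadraticWeyl, qComm] at hK hB
  rw [quadraticDefect] at hL
  refine ⟨uX, uM.ringInverse, uK, qWeyl_of_qComm hq2 (qComm_inverse_right uM ?_),
    qWeyl_of_qComm hq2 (qComm_inverse_left uM ?_), qWeyl_of_qComm hq2 ?_⟩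
  · simp only [qComm, mapM, mul_sub, sub_mul, mul_smul_comm, smul_mul_assoc]
    linear_combination (norm := skip) (a * a * (a - a⁻¹)⁻¹) • hK - (a - a⁻¹)⁻¹ • hB
      - ((q - q⁻¹) * a / (a - a⁻¹) ^ 2) • hL
    match_scalars <;> field_simp <;> ring
  · simp only [qComm, mapM, mul_sub, sub_mul, mul_smul_comm, smul_mul_assoc]
    linear_combination (norm := skip) (-((q - q⁻¹) * a⁻¹ / (a - a⁻¹) ^ 2)) • hL
    match_scalars <;> field_simp <;> ring
  · simp only [qComm, mul_sub, sub_mul, mul_smul_comm, smul_mul_assoc]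
    linear_combination (norm := skip) a • hK
    match_scalars <;> field_simp <;> ring

/-- The previous lemma for K⁻¹, B⁻¹, q⁻¹, a⁻¹, read backwards. -/
lemma isEquitable_inverse [FiniteDimensional F V] {q a : F} (hq0 : q ≠ 0) (hq2 : q - q⁻¹ ≠ 0)
    (ha : a ≠ 0) (ha2 : a - a⁻¹ ≠ 0) {A K B : Module.End F V} (hK : QuadraticWeyl q a K A)
    (hB : QuadraticWeyl q a⁻¹ B A) (hL : quadraticDefect q a K B = 0) (uK : IsUnit K)
    (uB : IsUnit B) (uM : IsUnit (mapM a K B))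
    (uZ : IsUnit (a⁻¹ • A - (a ^ 2)⁻¹ • Ring.inverse K)) :
    IsEquitable q (Ring.inverse K) (Ring.inverse (mapN a K B))
      (a⁻¹ • A - (a ^ 2)⁻¹ • Ring.inverse K) := by
  have hK1 := Ring.mul_inverse_cancel K uK
  have hK2 := Ring.inverse_mul_cancel K uK
  have hB1 := Ring.mul_inverse_cancel B uB
  have hB2 := Ring.inverse_mul_cancel B uB
  have uN : IsUnit (mapN a K B) := by
    rw [mapN_eq uK uB]
    exact (uK.ringInverse.mul uM).mul uB.ringInverse
  have hqi : q⁻¹ - q⁻¹⁻¹ ≠ 0 := by rw [inv_inv, ← neg_sub]; exact neg_ne_zero.mpr hq2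
  have hai : a⁻¹ - a⁻¹⁻¹ ≠ 0 := by rw [inv_inv, ← neg_sub]; exact neg_ne_zero.mpr ha2
  have := isEquitable_of_quadraticDefect_eq_zero (inv_ne_zero hq0) hqi (inv_ne_zero ha) hai
    (hK.inverse hK1 hK2) (hB.inverse hB1 hB2)
    (quadraticDefect_inverse hq0 hq2 ha ha2 hK1 hK2 hB1 hB2 hL) uK.ringInverse
    (by rwa [mapM_inverse]) (by rwa [inv_pow])
  rw [mapM_inverse, inv_pow] at this
  exact this.reverse

/-- An endomorphism that acts on the successive quotients of a flag as nonzero scalars is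
invertible. -/
lemma isUnit_of_flag [FiniteDimensional F V] {X : Module.End F V} {G : ℕ → Submodule F V} {m : ℕ}
    (h0 : G 0 = ⊤) (hm : G m = ⊥)
    (hX : ∀ n < m, ∃ c : F, c ≠ 0 ∧ ∀ v ∈ G n, X v - c • v ∈ G (n + 1)) : IsUnit X := by
  rw [LinearMap.isUnit_iff_ker_eq_bot, eq_bot_iff]
  intro v hv
  rw [LinearMap.mem_ker] at hv
  have key : ∀ n ≤ m, v ∈ G n := by
    intro n
    induction n with
    | zero => intro _; rw [h0]; trivial
    | succ n ih =>
      intro hn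
      obtain ⟨c, hc, h⟩ := hX n hn
      have := h v (ih (by omega))
      rwa [hv, zero_sub, Submodule.neg_mem_iff, Submodule.smul_mem_iff _ hc] at this
  exact hm ▸ key m le_rfl

lemma apply_mem_sup_map {T X : Module.End F V} {U : Submodule F V} (hT : ∀ v ∈ U, T v ∈ U)
    {k r s t : F} (hTX : T * X = k • (X * T) + r • (s • (T * T) + t • (1 : Module.End F V))) :
    ∀ v ∈ U ⊔ U.map X, T v ∈ U ⊔ U.map X := by
  intro v hv
  obtain ⟨u, hu, _, ⟨u', hu', rfl⟩, rfl⟩ := Submodule.mem_sup.mp hv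
  have := LinearMap.congr_fun hTX u'
  simp only [Module.End.mul_apply, LinearMap.add_apply, LinearMap.smul_apply,
    Module.End.one_apply] at this
  have h1 : T u + r • (s • T (T u') + t • u') ∈ U := U.add_mem (hT u hu)
    (U.smul_mem _ (U.add_mem (U.smul_mem _ (hT _ (hT u' hu'))) (U.smul_mem _ hu')))
  have h2 : k • X (T u') ∈ U.map X :=
    Submodule.smul_mem _ _ (Submodule.mem_map_of_mem (hT u' hu'))
  rw [map_add, this, add_left_comm, add_comm]
  exact Submodule.add_mem_sup h1 h2

/-- The largest subspace that is stable under `K` and `B` and killed by `D` is stable under any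
`X` that satisfies suitable exchange relations. -/
lemma apply_mem_of_exchange {D K B X : Module.End F V} {U : Submodule F V}
    (hD : ∀ v ∈ U, D v = 0) (hK : ∀ v ∈ U, K v ∈ U) (hB : ∀ v ∈ U, B v ∈ U)
    (hmax : ∀ N : Submodule F V, (∀ v ∈ N, D v = 0) → (∀ v ∈ N, K v ∈ N) → (∀ v ∈ N, B v ∈ N) →
      N ≤ U)
    {P : Module.End F V} {c k r z w : F}
    (hDX : D * X = c • (X * D) + P * D + D * (z • K + w • B))
    {s s' : F} (hKX : K * X = k • (X * K) + r • (s • (K * K) + s' • (1 : Module.End F V)))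
    {t t' : F} (hBX : B * X = k • (X * B) + r • (t • (B * B) + t' • (1 : Module.End F V))) :
    ∀ v ∈ U, X v ∈ U := by
  have hle : U ⊔ U.map X ≤ U := by
    refine hmax _ (fun v hv => ?_) (apply_mem_sup_map hK hKX) (apply_mem_sup_map hB hBX)
    obtain ⟨u, hu, _, ⟨u', hu', rfl⟩, rfl⟩ := Submodule.mem_sup.mp hv
    have := LinearMap.congr_fun hDX u'
    simp only [Module.End.mul_apply, LinearMap.add_apply, LinearMap.smul_apply, hD u' hu',
      map_zero, smul_zero, map_add, map_smul, hD _ (hK u' hu'), hD _ (hB u' hu'), add_zero]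
      at this
    rw [map_add, hD u hu, this, add_zero]
  intro v hv
  exact hle (Submodule.mem_sup_right (Submodule.mem_map_of_mem hv))

/-- The quadratic expression vanishes as soon as it kills a nonzero subspace stable under `K`
and `B`. -/
lemma quadraticDefect_eq_zero {q a b : F} (hq0 : q ≠ 0) (hq2 : q - q⁻¹ ≠ 0) (ha : a ≠ 0)
    (ha2 : a - a⁻¹ ≠ 0) (hb : b ≠ 0) {A As K B : Module.End F V} (hirr : IsIrreduciblePair A As)
    (hK : QuadraticWeyl q a K A) (hB : QuadraticWeyl q a⁻¹ B A) (hKs : QuadraticWeyl q⁻¹ b K As)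
    (hBs : QuadraticWeyl q⁻¹ b B As) {N : Submodule F V} (hN : N ≠ ⊥)
    (hNL : ∀ v ∈ N, quadraticDefect q a K B v = 0) (hNK : ∀ v ∈ N, K v ∈ N)
    (hNB : ∀ v ∈ N, B v ∈ N) : quadraticDefect q a K B = 0 := by
  set D := quadraticDefect q a K B with hD
  -- The three conditions pass to sums, so the supremum of S is its largest element.
  set S : Set (Submodule F V) :=
    {N | N ≤ LinearMap.ker D ∧ N ≤ N.comap K ∧ N ≤ N.comap B} with hS
  have hUD : ∀ v ∈ sSup S, D v = 0 := by
    have : sSup S ≤ LinearMap.ker D := sSup_le fun N hN => hN.1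
    exact this
  have hUK : ∀ v ∈ sSup S, K v ∈ sSup S := by
    have : sSup S ≤ (sSup S).comap K := sSup_le fun N hN =>
      hN.2.1.trans (Submodule.comap_mono (le_sSup hN))
    exact this
  have hUB : ∀ v ∈ sSup S, B v ∈ sSup S := by
    have : sSup S ≤ (sSup S).comap B := sSup_le fun N hN =>
      hN.2.2.trans (Submodule.comap_mono (le_sSup hN))
    exact this
  have hmax : ∀ N : Submodule F V, (∀ v ∈ N, D v = 0) → (∀ v ∈ N, K v ∈ N) →
      (∀ v ∈ N, B v ∈ N) → N ≤ sSup S := fun N h1 h2 h3 => le_sSup ⟨h1, h2, h3⟩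
  obtain ⟨x, y, z, w, hDA⟩ := quadraticDefect_mul hq0 hq2 ha ha2 hK hB
  obtain ⟨x', y', z', w', hDAs⟩ := quadraticDefect_mul_dual hq0 hq2 ha ha2 hb hKs hBs
  have htop := (hirr (sSup S)
    (apply_mem_of_exchange hUD hUK hUB hmax hDA (hK.mul_eq hq0) (hB.mul_eq hq0))
    (apply_mem_of_exchange hUD hUK hUB hmax hDAs (hKs.mul_eq (inv_ne_zero hq0))
      (hBs.mul_eq (inv_ne_zero hq0)))).resolve_left
    fun hbot => hN (le_bot_iff.mp (hbot ▸ hmax N hNL hNK hNB))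
  ext v
  exact hUD v (htop ▸ Submodule.mem_top)

end equitable

/-! ### Split maps of a tridiagonal system. -/

section system

variable {F : Type*} [Field F] {V : Type*} [AddCommGroup V] [Module F V]

namespace IsTridiagonalSystem

variable {A As : Module.End F V} {d : ℕ} {θ θs : Fin (d + 1) → F}

/-- Consecutive eigenvalues of `A*` are adjacent: this is a consequence of irreducibility and the
`q`-Dolan/Grady relation. -/
lemma adjacent_As {q : F} (hq0 : q ≠ 0) (h : IsTridiagonalSystem A As θ θs)
    (hAs : IsDiagonalizable As) (hDG : DolanGrady q As A) {i j : Fin (d + 1)}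
    (hij : (i : ℕ) + 1 = (j : ℕ)) : Adjacent q (θs i) (θs j) := by
  by_contra hcon
  have hstab : eigBelow As θs (i + 1) ≤ (eigBelow As θs (i + 1)).comap A := by
    refine iSup₂_le fun k hk v hv => ?_
    rw [Submodule.mem_comap]
    rcases Nat.lt_succ_iff_lt_or_eq.mp hk with hki | hki
    · have h1 : v ∈ eigBelow As θs (k + 1) :=
        le_sumBelow (fun j => eigenspace As (θs j)) (Nat.lt_succ_self (k : ℕ)) hv
      have h2 : A v ∈ eigBelow As θs (k + 1 + 1) := h.tridiagonal_A.apply_mem_sumBelow h1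
      exact sumBelow_mono (fun j => eigenspace As (θs j)) (Nat.succ_le_succ hki) h2
    · obtain rfl := Fin.ext hki
      have h1 := h.tridiagonal_A k (Submodule.mem_map_of_mem hv)
      have h2 := h.list_As.biSup_le _ (hDG.apply_mem hq0 hAs hv)
      -- Tridiagonality allows only the neighbouring indices, Dolan/Grady only adjacent eigenvalues;
      -- if θ*_i and θ*_{i+1} are not adjacent, the common part omits V*_{i+1} and the flag piece is
      -- stable.
      have h3 := (biSup_inf_biSup h.list_As.iSupIndep _ _).le ⟨h1, h2⟩
      refine (biSup_mono fun l hl => ?_ : (_ : Submodule F V) ≤ _) h3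
      obtain ⟨hl1, hl2⟩ := hl
      simp only [Set.mem_ofPred_eq] at hl1 hl2 ⊢
      by_contra hlt
      obtain rfl : l = j := Fin.ext (by omega)
      rcases hl2 with e | e
      · have := congrArg Fin.val (h.list_As.injective e)
        omega
      · exact hcon e.symm
  have hdis := disjoint_sumBelow_sumAbove _ h.list_As.iSupIndep ((i : ℕ) + 1)
  rcases h.irreducible (eigBelow As θs (i + 1)) (fun v hv => hstab hv) (fun v hv => by
    have := sumBelow_mono (fun j => eigenspace As (θs j)) (Nat.le_succ _)
      (apply_sub_mem_sumBelow hv)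
    rw [← sub_add_cancel (As v) (θs i • v)]
    exact Submodule.add_mem _ this (Submodule.smul_mem _ _ hv)) with hb | ht
  · exact h.list_As.ne_bot i (le_bot_iff.mp 
      ((le_sumBelow (fun j => eigenspace As (θs j)) (Nat.lt_succ_self (i : ℕ))).trans hb.le))
  · rw [eigBelow] at ht
    rw [ht, top_disjoint] at hdis
    exact h.list_As.ne_bot j (le_bot_iff.mp 
      ((le_sumAbove (fun j => eigenspace As (θs j)) hij.le).trans hdis.le))

lemma end_ext (h : IsTridiagonalSystem A As θ θs) {X Y : Module.End F V}
    (hXY : ∀ i : Fin (d + 1), ∀ w ∈ splitSpace A As θ θs i, X w = Y w) : X = Y := by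
  have : (⊤ : Submodule F V) ≤ LinearMap.eqLocus X Y := by
    rw [← h.iSup_fin_splitSpace]
    exact iSup_le fun i w hw => hXY i w hw
  ext v
  exact this trivial

section splitMap

variable {q : F} {K : Module.End F V}

/-- On U_i the raised part of A w has K-eigenvalue q⁻² times that of w, so it cancels in the
q-commutator and only the θ i term survives. -/
lemma quadraticWeyl {a : F} (hq0 : q ≠ 0) (ha : a ≠ 0) (h : IsTridiagonalSystem A As θ θs)
    (hθ : IsRacahSequence q a θ)
    (hK : IsSplitMap q (fun i => eigenspace As (θs i)) (fun i => eigenspace A (θ i)) K) :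
    QuadraticWeyl q a K A := by
  refine h.end_ext fun i w hw => ?_
  have hr := h.apply_A_mem_splitSpace hw
  obtain ⟨r, hr'⟩ : ∃ r, r = A w - θ i • w := ⟨_, rfl⟩
  rw [← hr'] at hr
  have hAw : A w = θ i • w + r := by rw [hr', add_sub_cancel]
  have hKw := h.apply_of_mem_splitSpace hK hw
  have hKr := h.apply_of_mem_splitSpace hK hr
  have e1 : (d : ℤ) - 2 * (((i : ℕ) + 1 : ℕ) : ℤ) = (d - 2 * ((i : ℕ) : ℤ)) - 2 := by
    push_cast; ring
  have e2 : 2 * ((i : ℕ) : ℤ) - (d : ℤ) = -(d - 2 * ((i : ℕ) : ℤ)) := by ring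
  have hθi := hθ i
  rw [e2, zpow_neg] at hθi
  rw [e1, zpow_sub₀ hq0] at hKr
  have hx : q ^ ((d : ℤ) - 2 * ((i : ℕ) : ℤ)) ≠ 0 := zpow_ne_zero _ hq0
  generalize q ^ ((d : ℤ) - 2 * ((i : ℕ) : ℤ)) = x at *
  simp only [qComm, LinearMap.sub_apply, LinearMap.add_apply, LinearMap.smul_apply,
    Module.End.mul_apply, Module.End.one_apply, hAw, hKw, hKr, map_add, map_smul]
  rw [hθi]
  match_scalars <;> field_simp
  ring

lemma quadraticWeyl_dual {b : F} (hq0 : q ≠ 0) (hb : b ≠ 0) (h : IsTridiagonalSystem A As θ θs)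
    (hθs : IsRacahSequence q b θs)
    (hK : IsSplitMap q (fun i => eigenspace As (θs i)) (fun i => eigenspace A (θ i)) K) :
    QuadraticWeyl q⁻¹ b K As := by
  refine h.end_ext fun i w hw => ?_
  obtain ⟨r, hr'⟩ : ∃ r, r = As w - θs i • w := ⟨_, rfl⟩
  have hAw : As w = θs i • w + r := by rw [hr', add_sub_cancel]
  have hKw := h.apply_of_mem_splitSpace hK hw
  have hKr : K r = (q ^ ((d : ℤ) - 2 * ((i : ℕ) : ℤ)) * q ^ 2) • r := by
    -- At i = 0 there is no lower component and r = 0.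
    rcases Nat.eq_zero_or_pos (i : ℕ) with h0 | hpos
    · have := apply_sub_mem_sumBelow hw.1
      rw [← hr', h0, sumBelow_zero, Submodule.mem_bot] at this
      simp [this]
    · have hr := h.apply_As_mem_splitSpace hw (n := (i : ℕ) - 1) (by omega)
      rw [← hr'] at hr
      rw [h.apply_of_mem_splitSpace hK hr]
      have e1 : (d : ℤ) - 2 * (((i : ℕ) - 1 : ℕ) : ℤ) = (d - 2 * ((i : ℕ) : ℤ)) + 2 := by
        omega
      rw [e1, zpow_add₀ hq0]
      norm_cast
  have e2 : 2 * ((i : ℕ) : ℤ) - (d : ℤ) = -(d - 2 * ((i : ℕ) : ℤ)) := by ring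
  have hθi := hθs i
  rw [e2, zpow_neg] at hθi
  have hx : q ^ ((d : ℤ) - 2 * ((i : ℕ) : ℤ)) ≠ 0 := zpow_ne_zero _ hq0
  generalize q ^ ((d : ℤ) - 2 * ((i : ℕ) : ℤ)) = x at *
  simp only [qComm, LinearMap.sub_apply, LinearMap.add_apply, LinearMap.smul_apply,
    Module.End.mul_apply, Module.End.one_apply, hAw, hKw, hKr, map_add, map_smul]
  rw [hθi]
  match_scalars <;> field_simp
  ring

lemma eigAbove_eq_sup (h : IsTridiagonalSystem A As θ θs) (n : ℕ) :
    eigAbove A θ n = splitSpace A As θ θs n ⊔ eigAbove A θ (n + 1) := by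
  rw [splitSpace, inf_comm, inf_sup_assoc_of_le _ (sumAbove_anti _ (Nat.le_succ _)),
    (h.codisjoint (n + 1)).eq_top, inf_top_eq]

lemma sub_mem_eigBelow (h : IsTridiagonalSystem A As θ θs)
    (hK : IsSplitMap q (fun i => eigenspace As (θs i)) (fun i => eigenspace A (θ i)) K) (n : ℕ) :
    ∀ v ∈ eigBelow As θs (n + 1), K v - q ^ ((d : ℤ) - 2 * (n : ℤ)) • v ∈ eigBelow As θs n := by
  have hstab : ∀ n, ∀ v ∈ eigBelow As θs n, K v ∈ eigBelow As θs n := by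
    intro n
    induction n with
    | zero =>
      intro v hv
      rw [eigBelow, sumBelow_zero, Submodule.mem_bot] at hv ⊢
      rw [hv, map_zero]
    | succ n ih =>
      intro v hv
      rw [h.eigBelow_succ] at hv ⊢
      obtain ⟨u, hu, w, hw, rfl⟩ := Submodule.mem_sup.mp hv
      rw [map_add, h.apply_of_mem_splitSpace hK hw]
      exact Submodule.add_mem_sup (ih u hu) (Submodule.smul_mem _ _ hw)
  intro v hv
  rw [h.eigBelow_succ] at hv
  obtain ⟨u, hu, w, hw, rfl⟩ := Submodule.mem_sup.mp hv
  rw [map_add, h.apply_of_mem_splitSpace hK hw, smul_add, add_sub_add_right_eq_sub]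
  exact Submodule.sub_mem _ (hstab n u hu) (Submodule.smul_mem _ _ hu)

lemma apply_mem_eigAbove (h : IsTridiagonalSystem A As θ θs)
    (hK : IsSplitMap q (fun i => eigenspace As (θs i)) (fun i => eigenspace A (θ i)) K) (n : ℕ) :
    ∀ v ∈ eigAbove A θ n, K v ∈ eigAbove A θ n := by
  suffices hs : eigAbove A θ n ≤ (eigAbove A θ n).comap K from hs
  nth_rewrite 1 [← h.sumAbove_splitSpace]
  refine iSup₂_le fun i hi w hw => ?_
  rw [Submodule.mem_comap, h.apply_of_mem_splitSpace hK hw]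
  exact Submodule.smul_mem _ _ (sumAbove_anti _ hi hw.2)

lemma sub_mem_eigAbove (h : IsTridiagonalSystem A As θ θs)
    (hK : IsSplitMap q (fun i => eigenspace As (θs i)) (fun i => eigenspace A (θ i)) K) (n : ℕ) :
    ∀ v ∈ eigAbove A θ n, K v - q ^ ((d : ℤ) - 2 * (n : ℤ)) • v ∈ eigAbove A θ (n + 1) := by
  intro v hv
  rw [h.eigAbove_eq_sup] at hv
  obtain ⟨w, hw, u, hu, rfl⟩ := Submodule.mem_sup.mp hv
  rw [map_add, h.apply_of_mem_splitSpace hK hw, smul_add, add_sub_add_left_eq_sub]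
  exact Submodule.sub_mem _ (h.apply_mem_eigAbove hK _ u hu) (Submodule.smul_mem _ _ hu)

variable [FiniteDimensional F V]

lemma isUnit_of_sub_mem_eigBelow (h : IsTridiagonalSystem A As θ θs) (hq0 : q ≠ 0)
    (hK : ∀ n : ℕ, ∀ v ∈ eigBelow As θs (n + 1),
      K v - q ^ ((d : ℤ) - 2 * (n : ℤ)) • v ∈ eigBelow As θs n) : IsUnit K := by
  -- The flag criterion wants a decreasing flag, hence the index d + 1 - n.
  refine isUnit_of_flag (G := fun n => eigBelow As θs (d + 1 - n)) (m := d + 1)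
    (sumBelow_eq_top _ h.iSup_As (by omega)) ?_ fun n hn => ?_
  · rw [Nat.sub_self]
    exact sumBelow_zero _
  · refine ⟨_, zpow_ne_zero _ hq0, fun v hv => hK (d + 1 - (n + 1)) v ?_⟩
    rwa [show d + 1 - (n + 1) + 1 = d + 1 - n by omega]

lemma isUnit_splitMap (h : IsTridiagonalSystem A As θ θs) (hq0 : q ≠ 0)
    (hK : IsSplitMap q (fun i => eigenspace As (θs i)) (fun i => eigenspace A (θ i)) K) :
    IsUnit K :=
  h.isUnit_of_sub_mem_eigBelow hq0 (h.sub_mem_eigBelow hK)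

lemma isUnit_smul_sub {a : F} (h : IsTridiagonalSystem A As θ θs) (hq0 : q ≠ 0) (ha : a ≠ 0)
    (hθ : IsRacahSequence q a θ)
    (hK : IsSplitMap q (fun i => eigenspace As (θs i)) (fun i => eigenspace A (θ i)) K) :
    IsUnit (a • A - a ^ 2 • K) := by
  -- The diagonal entry is a θ_n - a² q^{d-2n} = q^{2n-d}.
  refine isUnit_of_flag (G := eigAbove A θ) (m := d + 1) (sumAbove_zero _ h.iSup_A)
    (sumAbove_eq_bot _ (by omega)) fun n hn =>
      ⟨_, zpow_ne_zero (2 * (n : ℤ) - d) hq0, fun v hv => ?_⟩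
  have h1 := h.sub_mem_eigAbove hK n v hv
  have h2 := apply_sub_mem_sumAbove (i := ⟨n, hn⟩) hv
  rw [hθ] at h2
  convert Submodule.sub_mem _ (Submodule.smul_mem _ a h2) (Submodule.smul_mem _ (a ^ 2) h1) using 1
  simp only [LinearMap.sub_apply, LinearMap.smul_apply]
  match_scalars <;> field_simp
  ring

lemma isUnit_smul_sub_inverse {a : F} (h : IsTridiagonalSystem A As θ θs) (hq0 : q ≠ 0)
    (ha : a ≠ 0) (hθ : IsRacahSequence q a θ)
    (hK : IsSplitMap q (fun i => eigenspace As (θs i)) (fun i => eigenspace A (θ i)) K) :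
    IsUnit (a⁻¹ • A - (a ^ 2)⁻¹ • Ring.inverse K) := by
  have uK := h.isUnit_splitMap hq0 hK
  -- Multiplying by K removes the inverse: a⁻¹KA - a⁻² is triangular on the A flag with diagonal
  -- entries x², where x = q^{d-2n}.
  suffices hs : IsUnit (K * (a⁻¹ • A - (a ^ 2)⁻¹ • Ring.inverse K)) from
    (Units.isUnit_units_mul uK.unit _).mp hs
  rw [mul_sub, mul_smul_comm, mul_smul_comm, Ring.mul_inverse_cancel K uK]
  refine isUnit_of_flag (G := eigAbove A θ) (m := d + 1) (sumAbove_zero _ h.iSup_A)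
    (sumAbove_eq_bot _ (by omega)) fun n hn =>
      ⟨_, pow_ne_zero 2 (zpow_ne_zero ((d : ℤ) - 2 * (n : ℤ)) hq0), fun v hv => ?_⟩
  have h1 := h.sub_mem_eigAbove hK n v hv
  have h2 := apply_sub_mem_sumAbove (i := ⟨n, hn⟩) hv
  have h3 := h.apply_mem_eigAbove hK _ _ h2
  have e2 : 2 * (n : ℤ) - (d : ℤ) = -(d - 2 * (n : ℤ)) := by ring
  rw [hθ] at h3
  simp only [e2, zpow_neg] at h3
  have hx : q ^ ((d : ℤ) - 2 * (n : ℤ)) ≠ 0 := zpow_ne_zero _ hq0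
  generalize q ^ ((d : ℤ) - 2 * (n : ℤ)) = x at *
  convert Submodule.add_mem _ (Submodule.smul_mem _ a⁻¹ h3)
    (Submodule.smul_mem _ (a⁻¹ * (a * x + a⁻¹ * x⁻¹)) h1) using 1
  simp only [LinearMap.sub_apply, LinearMap.smul_apply, Module.End.mul_apply,
    Module.End.one_apply, map_sub, map_smul]
  match_scalars <;> field_simp <;> ring

end splitMap

variable [FiniteDimensional F V]

/-- The maps attached to the two split decompositions drawn from the same ordering of `A*`. -/
theorem isEquitable_splitMaps {q a b : F} (hq0 : q ≠ 0) (hq2 : q - q⁻¹ ≠ 0)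
    (h : IsTridiagonalSystem A As θ θs) (ha : a ≠ 0) (ha2 : a - a⁻¹ ≠ 0) (hb : b ≠ 0)
    (hθ : IsRacahSequence q a θ) (hθs : IsRacahSequence q b θs) {K B : Module.End F V}
    (hK : IsSplitMap q (fun i => eigenspace As (θs i)) (fun i => eigenspace A (θ i)) K)
    (hB : IsSplitMap q (fun i => eigenspace As (θs i))
      (fun i => eigenspace A ((θ ∘ Fin.rev) i)) B) :
    (IsUnit K ∧ IsUnit B ∧ IsUnit (mapM a K B) ∧ IsUnit (mapN a K B)) ∧
      IsEquitable q (a • A - a ^ 2 • K) (Ring.inverse (mapM a K B)) K ∧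
      IsEquitable q (a⁻¹ • A - (a ^ 2)⁻¹ • B) (Ring.inverse (mapM a K B)) B ∧
      IsEquitable q (Ring.inverse K) (Ring.inverse (mapN a K B))
        (a⁻¹ • A - (a ^ 2)⁻¹ • Ring.inverse K) ∧
      IsEquitable q (Ring.inverse B) (Ring.inverse (mapN a K B))
        (a • A - a ^ 2 • Ring.inverse B) := by
  have h' := h.comp_rev_left
  have hai := inv_ne_zero ha
  have hai2 : a⁻¹ - a⁻¹⁻¹ ≠ 0 := by rw [inv_inv, ← neg_sub]; exact neg_ne_zero.mpr ha2
  have uK := h.isUnit_splitMap hq0 hK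
  have uB := h'.isUnit_splitMap hq0 hB
  have wK := h.quadraticWeyl hq0 ha hθ hK
  have wB := h'.quadraticWeyl hq0 hai hθ.comp_rev hB
  have wB' : QuadraticWeyl q a⁻¹⁻¹ K A := by rwa [inv_inv]
  -- K and B are triangular on the same A* flag with equal diagonals, and the weights in M add up to
  -- 1.
  have uM : IsUnit (mapM a K B) := h.isUnit_of_sub_mem_eigBelow hq0 fun n v hv => by
    have h1 := h.sub_mem_eigBelow hK n v hv
    have h2 := h'.sub_mem_eigBelow hB n v hv
    convert Submodule.smul_mem _ (a - a⁻¹)⁻¹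
      (Submodule.sub_mem _ (Submodule.smul_mem _ a h1) (Submodule.smul_mem _ a⁻¹ h2)) using 1
    have ha2' := sq_sub_one_ne_zero ha ha2
    simp only [mapM, LinearMap.sub_apply, LinearMap.smul_apply]
    match_scalars <;> field_simp
    ring
  have uN : IsUnit (mapN a K B) := by
    rw [mapN_eq uK uB]
    exact (uK.ringInverse.mul uM).mul uB.ringInverse
  have hL : quadraticDefect q a K B = 0 := by
    have hq2' := sq_sub_one_ne_zero hq0 hq2
    have hK0 : ∀ v ∈ eigBelow As θs 1, K v = q ^ d • v := fun v hv => by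
      have := h.apply_of_mem_splitSpace hK (n := 0)
        ⟨hv, by rw [eigAbove, sumAbove_zero _ h.iSup_A]; trivial⟩
      simpa using this
    have hB0 : ∀ v ∈ eigBelow As θs 1, B v = q ^ d • v := fun v hv => by
      have := h'.apply_of_mem_splitSpace hB (n := 0)
        ⟨hv, by rw [eigAbove, sumAbove_zero _ h'.iSup_A]; trivial⟩
      simpa using this
    -- On V*_0 both maps are q^d, and the coefficients of D sum to 0.
    refine quadraticDefect_eq_zero hq0 hq2 ha ha2 hb h.irreducible wK wB
      (h.quadraticWeyl_dual hq0 hb hθs hK) (h'.quadraticWeyl_dual hq0 hb hθs hB)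
      (N := eigBelow As θs 1) (fun e => ?_) (fun v hv => ?_) (fun v hv => ?_) fun v hv => ?_
    · exact h.list_As.ne_bot 0 (le_bot_iff.mp 
        ((le_sumBelow (fun j => eigenspace As (θs j)) (by simp)).trans e.le))
    · simp only [quadraticDefect, LinearMap.sub_apply, LinearMap.add_apply, LinearMap.smul_apply,
        Module.End.mul_apply, hK0 v hv, hB0 v hv, map_smul]
      match_scalars
      field_simp
      ring
    · rw [hK0 v hv]; exact Submodule.smul_mem _ _ hv
    · rw [hB0 v hv]; exact Submodule.smul_mem _ _ hv
  have hL' : quadraticDefect q a⁻¹ B K = 0 := by rwa [quadraticDefect_swap]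
  have uM' : IsUnit (mapM a⁻¹ B K) := by rwa [mapM_swap]
  have uX := h.isUnit_smul_sub hq0 ha hθ hK
  have uX' := h'.isUnit_smul_sub hq0 hai hθ.comp_rev hB
  have uZ := h.isUnit_smul_sub_inverse hq0 ha hθ hK
  have uZ' := h'.isUnit_smul_sub_inverse hq0 hai hθ.comp_rev hB
  have eN : mapN a⁻¹ B K = mapN a K B := by
    rw [← mapM_inverse, ← mapM_inverse, mapM_swap]
  have t1 := isEquitable_of_quadraticDefect_eq_zero hq0 hq2 ha ha2 wK wB hL uK uM uX
  have t2 := isEquitable_of_quadraticDefect_eq_zero hq0 hq2 hai hai2 wB wB' hL' uB uM' uX'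
  have t3 := isEquitable_inverse hq0 hq2 ha ha2 wK wB hL uK uB uM uZ
  have t4 := isEquitable_inverse hq0 hq2 hai hai2 wB wB' hL' uB uK uM' uZ'
  rw [mapM_swap, inv_pow] at t2
  rw [eN, inv_pow, inv_inv, inv_inv] at t4
  exact ⟨⟨uK, uB, uM, uN⟩, t1, t2, t3, t4⟩

end IsTridiagonalSystem

end system

/-! ### Passage from modules to tridiagonal systems. -/

section modules

variable {F : Type*} [Field F] (q : F) (V : Type*) [AddCommGroup V] [Module F V]
  [Module (QOnsager F q) V] [IsScalarTower F (QOnsager F q) V]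

lemma dolanGrady_act (x y : Bool) (hxy : x ≠ y) :
    DolanGrady q
      (Algebra.lsmul F F V (RingQuot.mkAlgHom F (Rel F q) (FreeAlgebra.ι F x)))
      (Algebra.lsmul F F V (RingQuot.mkAlgHom F (Rel F q) (FreeAlgebra.ι F y))) := by
  have h := congrArg (Algebra.lsmul F F V) (RingQuot.mkAlgHom_rel F (Rel.dg (q := q) x y hxy))
  simp only [qComm, LieRing.of_associative_ring_bracket, map_sub, map_mul, map_smul] at h
  rw [DolanGrady]
  simp only [qComm, LieRing.of_associative_ring_bracket]
  exact h

lemma dolanGrady_actA : DolanGrady q (actA q V) (actAs q V) :=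
  dolanGrady_act q V false true (by decide)

lemma dolanGrady_actAs : DolanGrady q (actAs q V) (actA q V) :=
  dolanGrady_act q V true false (by decide)

/-- Stability under the generators spreads to the free algebra, which maps onto the q-Onsager
algebra. -/
lemma isIrreduciblePair_act [IsSimpleModule (QOnsager F q) V] :
    IsIrreduciblePair (actA q V) (actAs q V) := by
  intro U hA hAs
  have hfree : ∀ x : FreeAlgebra F Bool, ∀ v ∈ U,
      Algebra.lsmul F F V (RingQuot.mkAlgHom F (Rel F q) x) v ∈ U := by
    intro x
    induction x using FreeAlgebra.induction with
    | grade0 r =>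
      intro v hv
      rw [AlgHom.commutes, AlgHom.commutes, Module.algebraMap_end_apply]
      exact U.smul_mem _ hv
    | grade1 b =>
      cases b
      · exact hA
      · exact hAs
    | mul x y hx hy =>
      intro v hv
      rw [map_mul, map_mul, Module.End.mul_apply]
      exact hx _ (hy v hv)
    | add x y hx hy =>
      intro v hv
      rw [map_add, map_add, LinearMap.add_apply]
      exact U.add_mem (hx v hv) (hy v hv)
  let U' : Submodule (QOnsager F q) V :=
    { U.toAddSubmonoid with
      smul_mem' := fun x v hv => by
        obtain ⟨y, rfl⟩ := RingQuot.mkAlgHom_surjective F (Rel F q) x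
        exact hfree y v hv }
  have hmem : ∀ v, v ∈ U' ↔ v ∈ U := fun _ => Iff.rfl
  rcases eq_bot_or_eq_top U' with h | h
  · left
    ext v
    rw [← hmem, h, Submodule.mem_bot, Submodule.mem_bot]
  · right
    ext v
    rw [← hmem, h]
    simp

variable {q V}

/-- The tridiagonal action of A* on the V_i is not assumed; it follows from Dolan/Grady and the form
of the θ i. -/
lemma IsStandardOrdering.isTridiagonalSystem (hq0 : q ≠ 0)
    (hq : ∀ n : ℕ, 0 < n → q ^ n ≠ 1) [IsSimpleModule (QOnsager F q) V]
    (hA : IsDiagonalizable (actA q V)) (hAs : IsDiagonalizable (actAs q V)) {d : ℕ} (hd : 0 < d)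
    {θ θs : Fin (d + 1) → F} (h : IsStandardOrdering q V θ θs) :
    IsTridiagonalSystem (actA q V) (actAs q V) θ θs := by
  obtain ⟨a, ha, hθ⟩ := exists_isRacahSequence hq0 hq hd h.list_A.injective h.adjacent
  exact ⟨isIrreduciblePair_act q V, h.list_A, h.list_As, h.list_A.iSup_eq_top hA,
    h.list_As.iSup_eq_top hAs, h.three_term,
    (dolanGrady_actA q V).isTridiagonalOn hq0 hA h.list_A fun _ _ =>
      hθ.consecutive_of_adjacent hq0 hq ha h.list_A.injective⟩

end modules

end QOns

/-! ### Assembly of the proposition. -/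

theorem proposition7p4 {F : Type*} [Field F] (q : F) (hq0 : q ≠ 0)
    (hq : ∀ n : ℕ, 0 < n → q ^ n ≠ 1)
    (V : Type*) [AddCommGroup V] [Module F V] [Module (QOns.QOnsager F q) V]
    [IsScalarTower F (QOns.QOnsager F q) V] [IsSimpleModule (QOns.QOnsager F q) V]
    [FiniteDimensional F V] (hdim : 2 ≤ Module.finrank F V)
    (hA : QOns.IsDiagonalizable (QOns.actA q V))
    (hAs : QOns.IsDiagonalizable (QOns.actAs q V)) :
    (∃ (d : ℕ) (θ θs : Fin (d + 1) → F), QOns.IsStandardOrdering q V θ θs) ∧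
    ∀ (d : ℕ) (θ θs : Fin (d + 1) → F), QOns.IsStandardOrdering q V θ θs →
      (∃ (a : F) (K B Kd Bd : Module.End F V), QOns.IsSplitData q V θ θs a K B Kd Bd) ∧
      ∀ (a : F) (K B Kd Bd : Module.End F V), QOns.IsSplitData q V θ θs a K B Kd Bd →
        (a - a⁻¹ ≠ 0 ∧
          IsUnit K ∧ IsUnit B ∧ IsUnit Kd ∧ IsUnit Bd ∧
          IsUnit (QOns.mapM a K B) ∧ IsUnit (QOns.mapM a Kd Bd) ∧
          IsUnit (QOns.mapN a K B) ∧ IsUnit (QOns.mapN a Kd Bd)) ∧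
        QOns.IsEquitable q
          (a • QOns.actA q V - a ^ 2 • K) (Ring.inverse (QOns.mapM a K B)) K ∧
        QOns.IsEquitable q
          (a⁻¹ • QOns.actA q V - (a ^ 2)⁻¹ • B) (Ring.inverse (QOns.mapM a K B)) B ∧
        QOns.IsEquitable q
          (a • QOns.actA q V - a ^ 2 • Kd) (Ring.inverse (QOns.mapM a Kd Bd)) Kd ∧
        QOns.IsEquitable q
          (a⁻¹ • QOns.actA q V - (a ^ 2)⁻¹ • Bd) (Ring.inverse (QOns.mapM a Kd Bd)) Bd ∧
        QOns.IsEquitable q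
          (Ring.inverse K) (Ring.inverse (QOns.mapN a K B))
          (a⁻¹ • QOns.actA q V - (a ^ 2)⁻¹ • Ring.inverse K) ∧
        QOns.IsEquitable q
          (Ring.inverse B) (Ring.inverse (QOns.mapN a K B))
          (a • QOns.actA q V - a ^ 2 • Ring.inverse B) ∧
        QOns.IsEquitable q
          (Ring.inverse Kd) (Ring.inverse (QOns.mapN a Kd Bd))
          (a⁻¹ • QOns.actA q V - (a ^ 2)⁻¹ • Ring.inverse Kd) ∧
        QOns.IsEquitable q
          (Ring.inverse Bd) (Ring.inverse (QOns.mapN a Kd Bd))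
          (a • QOns.actA q V - a ^ 2 • Ring.inverse Bd) := by
  have hirr := QOns.isIrreduciblePair_act q V
  have hnt : Nontrivial V := Module.nontrivial_of_finrank_pos (R := F) (by omega)
  have hDG := QOns.dolanGrady_actA q V
  have hDGs := QOns.dolanGrady_actAs q V
  have hq2 : q - q⁻¹ ≠ 0 := fun h => by
    apply hq 2 (by norm_num)
    rw [sub_eq_zero] at h
    rw [pow_two]
    nth_rewrite 2 [h]
    exact mul_inv_cancel₀ hq0
  refine ⟨?_, fun d θ θs hstd => ?_⟩
  · obtain ⟨d, θ, hθ, hadj⟩ := QOns.exists_eigenvalueList hq0 hA hDG hirr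
    obtain ⟨δ, θs, hθs, hadjs⟩ := QOns.exists_eigenvalueList hq0 hAs hDGs hirr.symm
    have hd := QOns.pos_of_isEigenvalueList hdim hA hAs hirr hθ
    have hδ := QOns.pos_of_isEigenvalueList hdim hAs hA hirr.symm hθs
    obtain ⟨a, ha, hra⟩ := QOns.exists_isRacahSequence hq0 hq hd hθ.injective hadj
    obtain ⟨b, hb, hrb⟩ := QOns.exists_isRacahSequence hq0 hq hδ hθs.injective hadjs
    have h3 := hDG.isTridiagonalOn hq0 hA hθ fun _ _ =>
      hra.consecutive_of_adjacent hq0 hq ha hθ.injective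
    have h3s := hDGs.isTridiagonalOn hq0 hAs hθs fun _ _ =>
      hrb.consecutive_of_adjacent hq0 hq hb hθs.injective
    have hsys : QOns.IsTridiagonalSystem (QOns.actA q V) (QOns.actAs q V) θ θs :=
      ⟨hirr, hθ, hθs, hθ.iSup_eq_top hA, hθs.iSup_eq_top hAs, h3s, h3⟩
    -- The two eigenvalue lists were built independently; only here do their lengths agree.
    obtain rfl := hsys.length_eq
    exact ⟨d, θ, θs, hθ, hθs, hadj, h3s⟩
  have hd := QOns.pos_of_isEigenvalueList hdim hA hAs hirr hstd.list_A
  have hsys := hstd.isTridiagonalSystem hq0 hq hA hAs hd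
  refine ⟨?_, fun a K B Kd Bd hdata => ?_⟩
  · obtain ⟨a, ha, hra⟩ := QOns.exists_isRacahSequence hq0 hq hd hstd.list_A.injective
      hstd.adjacent
    obtain ⟨K, hK⟩ := hsys.exists_isSplitMap q
    obtain ⟨B, hB⟩ := hsys.comp_rev_left.exists_isSplitMap q
    obtain ⟨Kd, hKd⟩ := hsys.comp_rev_right.exists_isSplitMap q
    obtain ⟨Bd, hBd⟩ := hsys.comp_rev_right.comp_rev_left.exists_isSplitMap q
    exact ⟨a, K, B, Kd, Bd, ha, hra, hK, hB, hKd, hBd⟩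
  · have ha := hdata.a_ne_zero
    have hra : QOns.IsRacahSequence q a θ := hdata.theta_eq
    have ha2 := hra.sub_inv_ne_zero hd hstd.list_A.injective
    -- Adjacency of the θ*_i is not part of a standard ordering, so it is derived before b is
    -- extracted.
    obtain ⟨b, hb, hrb⟩ := QOns.exists_isRacahSequence hq0 hq hd hstd.list_As.injective
      fun _ _ => hsys.adjacent_As hq0 hAs hDGs
    obtain ⟨⟨uK, uB, uM, uN⟩, t1, t2, t5, t6⟩ := hsys.isEquitable_splitMaps hq0 hq2 ha ha2 hb hra
      hrb hdata.map_K hdata.map_B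
    obtain ⟨⟨uKd, uBd, uMd, uNd⟩, t3, t4, t7, t8⟩ :=
      hsys.comp_rev_right.isEquitable_splitMaps hq0 hq2 ha ha2 (inv_ne_zero hb) hra
        hrb.comp_rev hdata.map_Kd hdata.map_Bd
    exact ⟨⟨ha2, uK, uB, uKd, uBd, uM, uMd, uN, uNd⟩, t1, t2, t3, t4, t5, t6, t7, t8⟩
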